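/- Let $-\infty<a<b<\infty$, $t_0\in[a,b]$, $n\in\mathbb N\cup\{0\}$, $m,r\in\mathbb N=\{1,2,\dots\}$. For $k\ge 1$ let $W_1^{k}=W_1^{k}([a,b];\mathbb C)$ be the Sobolev space of functions $y\in C^{k-1}[a,b]$ with $y^{(k-1)}$ absolutely continuous (so $y^{(k)}\in L_1$), with norm $\sum_{s=0}^{k}\|y^{(s)}\|_{L_1}$, and $W_1^0=L_1([a,b];\mathbb C)$. Given matrix-valued functions $A_{j,0}\in (W_1^n)^{m\times m}$ $(0\le j\le r-1)$, numerical matrices $\alpha_{s,0}\in\mathbb C^{rm\times m}$ $(0\le s\le n+r-1)$ and $\Phi_0\in L_\infty([a,b];\mathbb C^{rm\times m})$, put $$L_0y=y^{(r)}+\sum_{j=0}^{r-1}A_{j,0}\,y^{(j)},\qquad B_0y=\sum_{s=0}^{n+r-1}\alpha_{s,0}\,y^{(s)}(t_0)+\int_a^b\Phi_0(t)\,y^{(n+r)}(t)\,dt ,\qquad y\in (W_1^{n+r})^m .$$ (Every bounded operator $B_0:(W_1^{n+r})^m\to\mathbb C^{rm}$ has a unique representation of this form.) Assume that the homogeneous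 problem $L_0y=0$, $B_0y=0$ has only the trivial solution in $(W_1^{n+r})^m$. Then $(L_0,B_0):(W_1^{n+r})^m\to (W_1^n)^m\times\mathbb C^{rm}$ is a topological isomorphism, and the following are equivalent. (1) There is a sequence of multipoint problems, $k\in\mathbb N$, $$L_ky=y^{(r)}+\sum_{j=0}^{r-1}A_{j,k}\,y^{(j)},\qquad B_ky=\sum_{s=0}^{n+r-1}\alpha_{s,k}\,y^{(s)}(t_0)+\sum_{j=0}^{N(k)}\beta_{j,k}\,y^{(n+r-1)}(t_{j,k}),$$ where the entries of the $A_{j,k}$ are algebraic polynomials, $\alpha_{s,k},\beta_{j,k}\in\mathbb C^{rm\times m}$ and $t_{j,k}\in[a,b]$, such that every $(L_k,B_k):(W_1^{n+r})^m\to (W_1^n)^m\times\mathbb C^{rm}$ is a topological isomorphism, and * $(L_k,B_k)^{-1}\to(L_0,B_0)^{-1}$ strongly; * for all $f_0\in(W_1^n)^m$, $c_0\in\mathbb C^{rm}$ there are polynomial $f_k$ with $f_k\to f_0$ in $(W_1^n)^m$, and for all polynomial $f_k\to f_0$ and all $c_k\to c_0$ the solutions $y_k$ of $L_ky_k=f_k$,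 $B_ky_k=c_k$ converge in $(W_1^{n+r})^m$ to the solution $y_0$ of $L_0y_0=f_0$, $B_0y_0=c_0$; * in addition, $\big\|(L_k,B_k)^{-1}-(L_0,B_0)^{-1}\big\|\to 0$ as $k\to\infty$ in the operator norm. (2) Each entry of $\Phi_0$ is equal almost everywhere on $[a,b]$ to a regulated function, i.e. to a function having finite one-sided limits at every point of $[a,b]$. -/

import Mathlib

open MeasureTheory Filter Topology Set

noncomputable section

/-- The complex Lebesgue space `L_1([a,b])`. -/
abbrev LOne (a b : ℝ) : Type := Lp ℂ 1 (volume.restrict (Icc a b))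

/-- The complex Lebesgue space `L_∞([a,b])`. -/
abbrev LInf (a b : ℝ) : Type := Lp ℂ ⊤ (volume.restrict (Icc a b))

/-- `F` is absolutely continuous on `[a,b]` and `F' = g` almost everywhere on `[a,b]`. -/
def IsACPrimitive (a b : ℝ) (F g : ℝ → ℂ) : Prop :=
  AbsolutelyContinuousOnInterval F a b ∧
    ∀ᵐ t ∂(volume.restrict (Icc a b)), HasDerivAt F (g t) t

/-- The Sobolev space `W_1^k([a,b]; ℂ)`. A function `y` is recorded together with its derivatives,
as the tuple `(y, y', …, y^(k))` of elements of `L_1([a,b])`: for each `s < k` the class `y^(s)` has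
an absolutely continuous representative whose derivative is `y^(s+1)` almost everywhere. (So
`y ∈ C^(k-1)`, `y^(k-1)` is absolutely continuous, `y^(k) ∈ L_1`; for `k = 0` this is `L_1`.)
The norm, inherited from the `ℓ¹`-product, is the sum over `s = 0, …, k` of the `L_1`-norms
of `y^(s)`. -/
def sobolevSubmodule (a b : ℝ) (k : ℕ) :
    Submodule ℂ (PiLp 1 (fun _ : Fin (k + 1) => LOne a b)) where
  carrier := {u | ∀ s : Fin k, ∃ F : ℝ → ℂ,
    IsACPrimitive a b F (u s.succ) ∧ u s.castSucc =ᵐ[volume.restrict (Icc a b)] F}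
  zero_mem' := by
    intro s
    refine ⟨fun _ => 0, ⟨?_, ?_⟩, ?_⟩
    · exact ((LipschitzWith.const (0 : ℂ)).lipschitzOnWith (s := uIcc a b)).absolutelyContinuousOnInterval
    · filter_upwards [Lp.coeFn_zero ℂ 1 (volume.restrict (Icc a b))] with t ht
      rw [PiLp.zero_apply, ht]
      exact hasDerivAt_const t (0 : ℂ)
    · rw [PiLp.zero_apply]
      exact Lp.coeFn_zero ℂ 1 (volume.restrict (Icc a b))
  add_mem' := by
    intro u v hu hv s
    obtain ⟨F, ⟨hF, hF'⟩, hFu⟩ := hu s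
    obtain ⟨G, ⟨hG, hG'⟩, hGv⟩ := hv s
    refine ⟨F + G, ⟨hF.add hG, ?_⟩, ?_⟩
    · filter_upwards [hF', hG', Lp.coeFn_add (u s.succ) (v s.succ)] with t h1 h2 h3
      rw [PiLp.add_apply, h3]
      exact h1.add h2
    · rw [PiLp.add_apply]
      exact (Lp.coeFn_add _ _).trans (hFu.add hGv)
  smul_mem' := by
    intro c u hu s
    obtain ⟨F, ⟨hF, hF'⟩, hFu⟩ := hu s
    refine ⟨fun t => c • F t, ⟨hF.const_smul c, ?_⟩, ?_⟩
    · filter_upwards [hF', Lp.coeFn_smul c (u s.succ)] with t h1 h2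
      rw [PiLp.smul_apply, h2]
      exact h1.const_smul c
    · rw [PiLp.smul_apply]
      exact (Lp.coeFn_smul _ _).trans (hFu.const_smul c)

/-- The Sobolev space `W_1^k([a,b]; ℂ)` as a normed space. -/
abbrev Sob (a b : ℝ) (k : ℕ) : Type := ↥(sobolevSubmodule a b k)

/-- The Sobolev space `(W_1^k)^m`, normed by the sum of the norms of the components. -/
abbrev SobVec (a b : ℝ) (k m : ℕ) : Type := PiLp 1 (fun _ : Fin m => Sob a b k)

namespace Sob

variable {a b : ℝ} {k : ℕ}

/-- The derivative `y^(s)`, `0 ≤ s ≤ k`, as a class in `L_1([a,b])`. -/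
def der (y : Sob a b k) (s : Fin (k + 1)) : LOne a b := y.1 s

/-- For `0 ≤ s ≤ k - 1`, the value `y^(s)(t)` at a point `t ∈ [a,b]` of the absolutely continuous
(hence, on `[a,b]`, unique) representative of `y^(s)`. -/
def derAt (y : Sob a b k) (s : Fin k) (t : ℝ) : ℂ := (y.2 s).choose t

/-- `y` is (the restriction to `[a,b]` of) an algebraic polynomial with complex coefficients. -/
def IsPolynomial (y : Sob a b k) : Prop :=
  ∃ P : Polynomial ℂ, y.der 0 =ᵐ[volume.restrict (Icc a b)] fun t => P.eval (t : ℂ)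

end Sob

/-- The domain `(W_1^{n+r})^m` of the boundary-value problem operators. -/
abbrev SolutionSpace (a b : ℝ) (n m r : ℕ) : Type := SobVec a b (n + r) m

/-- The space `(W_1^n)^m × ℂ^{rm}` of right-hand sides. -/
abbrev DataSpace (a b : ℝ) (n m r : ℕ) : Type := SobVec a b n m × (Fin (r * m) → ℂ)

section Operators

variable {a b : ℝ} {n m r : ℕ}

/-- The coefficients of a system: `A j` is the matrix-valued coefficient of `y^(j)`,
`0 ≤ j ≤ r - 1`, with entries in `W_1^n`. -/
abbrev Coefficients (a b : ℝ) (n m r : ℕ) : Type :=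
  Fin r → Matrix (Fin m) (Fin m) (Sob a b n)

/-- The differential expression `y^(r) + ∑_{j<r} A_j y^(j)`, defined almost everywhere. -/
def diffExpr (A : Coefficients a b n m r) (y : SolutionSpace a b n m r) (t : ℝ) (i : Fin m) : ℂ :=
  (y i).der ⟨r, by omega⟩ t +
    ∑ j : Fin r, ∑ l : Fin m, (A j i l).der 0 t * (y l).der ⟨j, by omega⟩ t

/-- The vector `y^(s)(t) ∈ ℂ^m`, for `0 ≤ s ≤ n + r - 1` and `t ∈ [a,b]`. -/
def pointDer (y : SolutionSpace a b n m r) (s : Fin (n + r)) (t : ℝ) : Fin m → ℂ :=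
  fun j => (y j).derAt s t

/-- The boundary operator in canonical form,
`B y = ∑_{s<n+r} α_s y^(s)(t₀) + ∫_a^b Φ(t) y^(n+r)(t) dt`. -/
def canonicalBoundary (t₀ : ℝ) (α : Fin (n + r) → Matrix (Fin (r * m)) (Fin m) ℂ)
    (Φ : Matrix (Fin (r * m)) (Fin m) (LInf a b)) (y : SolutionSpace a b n m r) :
    Fin (r * m) → ℂ :=
  (∑ s, (α s).mulVec (pointDer y s t₀)) +
    fun i => ∫ t in Icc a b, ∑ j, Φ i j t * (y j).der (Fin.last (n + r)) t

/-- The multipoint boundary operator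
`B y = ∑_{s<n+r} α_s y^(s)(t₀) + ∑_{j=0}^N β_j y^(n+r-1)(t_j)`. -/
def multipointBoundary (hr : 1 ≤ r) (t₀ : ℝ) (α : Fin (n + r) → Matrix (Fin (r * m)) (Fin m) ℂ)
    {N : ℕ} (β : Fin (N + 1) → Matrix (Fin (r * m)) (Fin m) ℂ) (node : Fin (N + 1) → ℝ)
    (y : SolutionSpace a b n m r) : Fin (r * m) → ℂ :=
  (∑ s, (α s).mulVec (pointDer y s t₀)) +
    ∑ j, (β j).mulVec (pointDer y ⟨n + r - 1, by omega⟩ (node j))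

/-- The map `T` is the operator `(L, B) : (W_1^{n+r})^m → (W_1^n)^m × ℂ^{rm}` of the boundary-value
problem with the coefficients `A` and the boundary operator `B`. -/
def IsProblemOperator (A : Coefficients a b n m r)
    (B : SolutionSpace a b n m r → Fin (r * m) → ℂ)
    (T : SolutionSpace a b n m r → DataSpace a b n m r) : Prop :=
  ∀ y, (∀ i, ((T y).1 i).der 0 =ᵐ[volume.restrict (Icc a b)] fun t => diffExpr A y t i) ∧
    (T y).2 = B y

end Operators

/-- The left-hand sides `(L, B)` of a multipoint boundary-value problem whose differential
system has polynomial coefficients. -/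
structure MultipointProblem (a b : ℝ) (n m r : ℕ) where
  /-- coefficients of the system -/
  A : Coefficients a b n m r
  /-- the coefficients are polynomials -/
  isPolynomial : ∀ j i l, (A j i l).IsPolynomial
  /-- matrices at the point `t₀` -/
  α : Fin (n + r) → Matrix (Fin (r * m)) (Fin m) ℂ
  /-- the nodes are numbered from `0` to `N` -/
  N : ℕ
  /-- matrices at the nodes -/
  β : Fin (N + 1) → Matrix (Fin (r * m)) (Fin m) ℂ
  /-- nodes -/
  node : Fin (N + 1) → ℝ
  /-- the nodes lie in `[a,b]` -/
  node_mem : ∀ j, node j ∈ Icc a b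

/-- `T k` are the (invertible) operators `(L_k, B_k)` of a sequence of well-posed multipoint
problems with polynomial coefficients which approximates the well-posed problem with the operator
`T₀ = (L_0, B_0)`: the inverses converge strongly, and for arbitrary right-hand sides
`(f₀, c₀)` there are polynomial `f_k → f₀`, and for all polynomial `f_k → f₀` and all `c_k → c₀`
the solutions `y_k` of the problems `(L_k, B_k) y_k = (f_k, c_k)` converge to the solution of the
problem `(L_0, B_0) y_0 = (f₀, c₀)`. -/
structure IsApproximation {a b : ℝ} {n m r : ℕ} (hr : 1 ≤ r) (t₀ : ℝ)
    (T₀ : SolutionSpace a b n m r ≃L[ℂ] DataSpace a b n m r)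
    (Q : ℕ → MultipointProblem a b n m r)
    (T : ℕ → (SolutionSpace a b n m r ≃L[ℂ] DataSpace a b n m r)) : Prop where
  isOperator : ∀ k, IsProblemOperator (Q k).A
    (multipointBoundary hr t₀ (Q k).α (Q k).β (Q k).node) (T k)
  strong : ∀ g : DataSpace a b n m r,
    Tendsto (fun k => (T k).symm g) atTop (𝓝 (T₀.symm g))
  exists_polynomial : ∀ f₀ : SobVec a b n m, ∃ f : ℕ → SobVec a b n m,
    (∀ k i, (f k i).IsPolynomial) ∧ Tendsto f atTop (𝓝 f₀)
  solutions : ∀ (f : ℕ → SobVec a b n m) (f₀ : SobVec a b n m)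
    (c : ℕ → Fin (r * m) → ℂ) (c₀ : Fin (r * m) → ℂ),
    (∀ k i, (f k i).IsPolynomial) → Tendsto f atTop (𝓝 f₀) → Tendsto c atTop (𝓝 c₀) →
      Tendsto (fun k => (T k).symm (f k, c k)) atTop (𝓝 (T₀.symm (f₀, c₀)))

/-- `φ` is regulated on `[a,b]`: it has finite one-sided limits at every point of `[a,b]`. -/
def IsRegulatedOn (a b : ℝ) (φ : ℝ → ℂ) : Prop :=
  (∀ t ∈ Ico a b, ∃ l : ℂ, Tendsto φ (𝓝[>] t) (𝓝 l)) ∧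
    (∀ t ∈ Ioc a b, ∃ l : ℂ, Tendsto φ (𝓝[<] t) (𝓝 l))

end

noncomputable section

/-! Well-posedness. The map `y ↦ (y^(r), (y^(s)(t₀))_{s<r})` is an isomorphism onto the data space,
by repeated integration (`bijective_initial`). The operator `(L_0, B_0)` differs from it by a
compact one: the boundary parts differ by an operator into a finite-dimensional space, and for `j <
r` the derivative `y^(j)` lies in `W_1^(n+1)`, one derivative more than the target `W_1^n` needs,
which makes multiplication by a fixed element of `W_1^n` compact (`Sob.exists_mul`). By the Fredholm
alternative (`exists_equiv_of_compact_perturbation`) a trivial kernel gives an isomorphism.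

Equivalence. Inversion is norm continuous, so norm convergence of the inverses is the same as norm
convergence `(L_k, B_k) → (L_0, B_0)`, and it implies the other convergence requirements in (1).
Polynomials are dense in `W_1^n`, so the coefficients of the system are no obstruction and only the
boundary operators matter. A difference of two values of `y^(n+r-1)` is the integral of `y^(n+r)`
over an interval, that is, its pairing with plus or minus an indicator (`pairing_cellInf`). So, up
to values at a fixed point, multipoint operators are canonical ones whose `Φ` is a step function.
The question becomes which `Φ` are limits of step functions in `L_∞`, and these are the classes of
regulated functions.

From (2) to (1): one-sided limits and compactness of `[a,b]` give uniform approximation by step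
functions (`mem_closure_stepSpan`). These yield multipoint problems that converge in norm and are
therefore eventually invertible (`exists_approximation`).

From (1) to (2): restricted to suitable test functions, norm convergence becomes convergence of
functionals on `L_1` given by step functions. Testing on indicators of short intervals bounds the
differences of these step functions pointwise (`norm_stepFun_sub_le`), so they converge uniformly
and the limit keeps one-sided limits (`exists_isRegulatedOn_of_tendsto`). -/

/-- Lebesgue measure on `[a,b]`. -/
abbrev volIcc (a b : ℝ) : Measure ℝ := volume.restrict (Icc a b)

/-! ### Primitives of `L_1` functions and absolute continuity. -/

section Primitive

variable {a b : ℝ}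

lemma integrable_indicator_Icc (g : LOne a b) :
    Integrable ((Icc a b).indicator (g : ℝ → ℂ)) volume :=
  (integrable_indicator_iff measurableSet_Icc).2 (L1.integrable_coeFn g)

/-- The primitive `x ↦ ∫_c^x g` of a function in `L_1([a,b])`, extended by zero to the line. -/
def prim (c : ℝ) (g : LOne a b) (x : ℝ) : ℂ := ∫ s in c..x, (Icc a b).indicator (g : ℝ → ℂ) s

@[simp] lemma prim_self (c : ℝ) (g : LOne a b) : prim c g c = 0 := by simp [prim]

lemma ae_restrict_indicator {p : ℂ → ℂ → ℂ → Prop} (h0 : p 0 0 0) {f g h : ℝ → ℂ}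
    (H : ∀ᵐ t ∂(volIcc a b), p (f t) (g t) (h t)) :
    ∀ᵐ t, p ((Icc a b).indicator f t) ((Icc a b).indicator g t) ((Icc a b).indicator h t) := by
  rw [ae_restrict_iff' measurableSet_Icc] at H
  filter_upwards [H] with t ht
  by_cases hm : t ∈ Icc a b
  · simpa [hm] using ht hm
  · simpa [hm] using h0

lemma prim_add (c : ℝ) (g h : LOne a b) (x : ℝ) : prim c (g + h) x = prim c g x + prim c h x := by
  rw [prim, prim, prim, ← intervalIntegral.integral_add
    (integrable_indicator_Icc g).intervalIntegrable (integrable_indicator_Icc h).intervalIntegrable]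
  refine intervalIntegral.integral_congr_ae ?_
  have := ae_restrict_indicator (a := a) (b := b) (p := fun x y z => x = y + z) (by simp)
    (Lp.coeFn_add g h)
  filter_upwards [this] with t ht _ using ht

lemma prim_smul (c : ℝ) (w : ℂ) (g : LOne a b) (x : ℝ) : prim c (w • g) x = w * prim c g x := by
  rw [prim, prim, ← intervalIntegral.integral_const_mul]
  refine intervalIntegral.integral_congr_ae ?_
  have := ae_restrict_indicator (a := a) (b := b) (p := fun x y _ => x = w * y) (by simp)
    (h := 0) (Lp.coeFn_smul w g)
  filter_upwards [this] with t ht _ using ht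

lemma norm_prim_le (c : ℝ) (g : LOne a b) (x : ℝ) : ‖prim c g x‖ ≤ ‖g‖ := by
  refine (intervalIntegral.norm_integral_le_integral_norm_uIoc).trans ?_
  refine (setIntegral_le_integral (integrable_indicator_Icc g).norm
    (ae_of_all _ fun _ => norm_nonneg _)).trans ?_
  rw [L1.norm_eq_integral_norm, ← integral_indicator measurableSet_Icc]
  refine le_of_eq (integral_congr_ae (ae_of_all _ fun t => ?_))
  simp [norm_indicator_eq_indicator_norm]

lemma prim_sub_prim (c : ℝ) (g : LOne a b) (x y : ℝ) :
    prim c g y - prim c g x = ∫ s in x..y, (Icc a b).indicator (g : ℝ → ℂ) s :=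
  intervalIntegral.integral_interval_sub_left (integrable_indicator_Icc g).intervalIntegrable
    (integrable_indicator_Icc g).intervalIntegrable

lemma prim_add_prim (c d : ℝ) (g : LOne a b) (x : ℝ) : prim c g d + prim d g x = prim c g x :=
  intervalIntegral.integral_add_adjacent_intervals (integrable_indicator_Icc g).intervalIntegrable
    (integrable_indicator_Icc g).intervalIntegrable

lemma continuous_prim (c : ℝ) (g : LOne a b) : Continuous (prim c g) :=
  intervalIntegral.continuous_primitive
    (fun _ _ => (integrable_indicator_Icc g).intervalIntegrable) c

lemma ae_hasDerivAt_prim (c : ℝ) (g : LOne a b) :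
    ∀ᵐ t ∂(volIcc a b), HasDerivAt (prim c g) (g t) t := by
  rw [ae_restrict_iff' measurableSet_Icc]
  filter_upwards
    [_root_.LocallyIntegrable.ae_hasDerivAt_integral (integrable_indicator_Icc g).locallyIntegrable]
    with t ht hm
  have h := ht c
  rw [indicator_of_mem hm] at h
  exact h

/-- The primitive of the norm of a function in `L_1([a,b])`. -/
def primNorm (c : ℝ) (g : LOne a b) (x : ℝ) : ℝ :=
  ∫ s in c..x, ‖(Icc a b).indicator (g : ℝ → ℂ) s‖

lemma primNorm_sub (c : ℝ) (g : LOne a b) (x y : ℝ) :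
    primNorm c g y - primNorm c g x = ∫ s in x..y, ‖(Icc a b).indicator (g : ℝ → ℂ) s‖ :=
  intervalIntegral.integral_interval_sub_left (integrable_indicator_Icc g).norm.intervalIntegrable
    (integrable_indicator_Icc g).norm.intervalIntegrable

lemma norm_prim_sub_le (c d : ℝ) (g : LOne a b) (x y : ℝ) :
    ‖prim c g y - prim c g x‖ ≤ |primNorm d g y - primNorm d g x| := by
  rw [prim_sub_prim, primNorm_sub]
  exact intervalIntegral.norm_integral_le_abs_integral_norm

lemma monotone_primNorm (c : ℝ) (g : LOne a b) : Monotone (primNorm c g) := by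
  intro x y hxy
  rw [← sub_nonneg, primNorm_sub]
  exact intervalIntegral.integral_nonneg hxy fun _ _ => norm_nonneg _

lemma primNorm_sub_le (c : ℝ) (g : LOne a b) {x y : ℝ} (hxy : x ≤ y) :
    primNorm c g y - primNorm c g x ≤ ‖g‖ := by
  rw [primNorm_sub, intervalIntegral.integral_of_le hxy]
  refine (setIntegral_le_integral (integrable_indicator_Icc g).norm
    (ae_of_all _ fun _ => norm_nonneg _)).trans ?_
  rw [L1.norm_eq_integral_norm, ← integral_indicator measurableSet_Icc]
  refine le_of_eq (integral_congr_ae (ae_of_all _ fun t => ?_))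
  simp [norm_indicator_eq_indicator_norm]

/-- Increments of the primitive are dominated by those of the primitive of `|g|`, whose absolute
continuity is known. -/
lemma absolutelyContinuous_prim (c : ℝ) (g : LOne a b) :
    AbsolutelyContinuousOnInterval (prim c g) a b := by
  have h := (integrable_indicator_Icc g).norm.intervalIntegrable.absolutelyContinuousOnInterval_intervalIntegral
    (a := a) (b := b) (c := a) left_mem_uIcc
  refine squeeze_zero (fun _ => Finset.sum_nonneg fun _ _ => dist_nonneg) (fun E => ?_) h
  refine Finset.sum_le_sum fun i _ => ?_
  rw [dist_comm, dist_eq_norm, dist_comm, Real.dist_eq]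
  exact norm_prim_sub_le c a g _ _

lemma isACPrimitive_const_add_prim (c : ℝ) (w : ℂ) (g : LOne a b) :
    IsACPrimitive a b (fun x => w + prim c g x) g := by
  refine ⟨AbsolutelyContinuousOnInterval.add (f := fun _ => w)
    ((LipschitzWith.const w).lipschitzOnWith (s := uIcc a b)).absolutelyContinuousOnInterval
    (absolutelyContinuous_prim c g), ?_⟩
  filter_upwards [ae_hasDerivAt_prim c g] with t ht using ht.const_add w

/-- `F - prim c g` is absolutely continuous with derivative zero almost everywhere, hence constant.
-/
lemma IsACPrimitive.eq_add_prim (hab : a < b) {F : ℝ → ℂ} {g : LOne a b}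
    (hF : IsACPrimitive a b F g) {c x : ℝ} (hc : c ∈ Icc a b) (hx : x ∈ Icc a b) :
    F x = F c + prim c g x := by
  have h1 : AbsolutelyContinuousOnInterval (fun x => F x - prim c g x) a b :=
    hF.1.sub (absolutelyContinuous_prim c g)
  have h2 : ∀ᵐ t, t ∈ uIcc a b → HasDerivAt (fun x => F x - prim c g x) 0 t := by
    have := hF.2.and (ae_hasDerivAt_prim c g)
    rw [ae_restrict_iff' measurableSet_Icc] at this
    rw [uIcc_of_le hab.le]
    filter_upwards [this] with t ht hm
    have h := (ht hm).1.sub (ht hm).2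
    rw [sub_self] at h
    exact h
  obtain ⟨C, hC⟩ := h1.const_of_ae_hasDerivAt_zero h2
  rw [uIcc_of_le hab.le] at hC
  have e1 := hC x hx
  have e2 := hC c hc
  simp only [prim_self, sub_zero] at e1 e2
  rw [e2, ← e1]; ring

lemma IsACPrimitive.deriv_unique (hab : a < b) {F G : ℝ → ℂ} {g h : LOne a b}
    (hF : IsACPrimitive a b F g) (hG : IsACPrimitive a b G h) (hFG : F =ᵐ[volIcc a b] G) :
    g = h := by
  have hc : EqOn F G (Icc a b) := by
    have h1 := hF.1.continuousOn
    have h2 := hG.1.continuousOn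
    rw [uIcc_of_le hab.le] at h1 h2
    exact Measure.eqOn_Icc_of_ae_eq volume hab.ne hFG h1 h2
  refine Lp.ext ?_
  -- The derivatives are two-sided while `F` and `G` agree only on `[a,b]`, so the endpoints are
  -- discarded.
  have hne : ∀ᵐ t ∂(volIcc a b), t ≠ a ∧ t ≠ b :=
    ae_restrict_of_ae ((by simp [ae_iff] : ∀ᵐ t, t ≠ a).and (by simp [ae_iff]))
  filter_upwards [hF.2, hG.2, hne, ae_restrict_mem measurableSet_Icc] with t h1 h2 h3 h4
  refine h1.unique (h2.congr_of_eventuallyEq ?_)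
  filter_upwards [Icc_mem_nhds (lt_of_le_of_ne h4.1 (Ne.symm h3.1)) (lt_of_le_of_ne h4.2 h3.2)]
    with x hx using hc hx

end Primitive

/-! ### Integration, multiplication and pairing as bounded operators on `L_1` and `L_∞`. -/

section LOperators

variable {a b : ℝ}

lemma memLp_top_const_add_prim (c : ℝ) (w : ℂ) (g : LOne a b) :
    MemLp (fun x => w + prim c g x) ⊤ (volIcc a b) :=
  memLp_top_of_bound ((continuous_const.add (continuous_prim c g)).aestronglyMeasurable)
    (‖w‖ + ‖g‖) (ae_of_all _ fun x => (norm_add_le _ _).trans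
      (add_le_add le_rfl (norm_prim_le c g x)))

/-- The operator `(w, g) ↦ w + ∫_c^x g` from `ℂ × L_1` to `L_∞`. -/
def affPrimInf (a b c : ℝ) : (ℂ × LOne a b) →L[ℂ] LInf a b :=
  LinearMap.mkContinuous
    { toFun := fun p => (memLp_top_const_add_prim c p.1 p.2).toLp _
      map_add' := fun p q => by
        rw [← MemLp.toLp_add]
        refine MemLp.toLp_congr _ _ (ae_of_all _ fun x => ?_)
        simp only [Prod.fst_add, Prod.snd_add, prim_add, Pi.add_apply]; ring
      map_smul' := fun w p => by
        rw [RingHom.id_apply, ← MemLp.toLp_const_smul]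
        refine MemLp.toLp_congr _ _ (ae_of_all _ fun x => ?_)
        simp only [Prod.smul_fst, Prod.smul_snd, prim_smul, Pi.smul_apply, smul_eq_mul]; ring }
    2 fun p => by
      have h : ∀ᵐ x ∂(volIcc a b),
          ‖((memLp_top_const_add_prim c p.1 p.2).toLp _ : LInf a b) x‖ ≤ ‖p.1‖ + ‖p.2‖ := by
        filter_upwards [(memLp_top_const_add_prim c p.1 p.2).coeFn_toLp] with x hx
        rw [hx]
        exact (norm_add_le _ _).trans (add_le_add le_rfl (norm_prim_le c p.2 x))
      have h2 := Lp.norm_le_of_ae_bound (by positivity) h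
      simp only [ENNReal.toReal_top, inv_zero, one_mul, Real.rpow_zero] at h2
      refine h2.trans ?_
      linarith [norm_fst_le p, norm_snd_le p]

lemma affPrimInf_ae (c : ℝ) (p : ℂ × LOne a b) :
    affPrimInf a b c p =ᵐ[volIcc a b] fun x => p.1 + prim c p.2 x :=
  (memLp_top_const_add_prim c p.1 p.2).coeFn_toLp

/-- Multiplication `L_1 × L_∞ → L_1`. -/
def mulOneInf (a b : ℝ) : LOne a b →L[ℂ] LInf a b →L[ℂ] LOne a b :=
  (ContinuousLinearMap.mul ℂ ℂ).holderL (volIcc a b) 1 ⊤ 1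

lemma mulOneInf_ae (f : LOne a b) (φ : LInf a b) :
    mulOneInf a b f φ =ᵐ[volIcc a b] fun x => f x * φ x :=
  (ContinuousLinearMap.mul ℂ ℂ).coeFn_holder f φ

/-- The inclusion of `L_∞` in `L_1`. -/
def inclInf (a b : ℝ) : LInf a b →L[ℂ] LOne a b :=
  mulOneInf a b (indicatorConstLp 1 MeasurableSet.univ (measure_ne_top _ _) 1)

lemma inclInf_ae (φ : LInf a b) : inclInf a b φ =ᵐ[volIcc a b] φ := by
  filter_upwards [mulOneInf_ae (indicatorConstLp 1 MeasurableSet.univ (measure_ne_top _ _) 1) φ,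
    indicatorConstLp_coeFn (p := 1) (μ := volIcc a b) (hs := MeasurableSet.univ)
      (hμs := measure_ne_top _ _) (c := (1 : ℂ))] with t h1 h2
  rw [inclInf, h1, h2]; simp

lemma mulOneInf_inclInf (φ ψ : LInf a b) :
    mulOneInf a b (inclInf a b φ) ψ = mulOneInf a b (inclInf a b ψ) φ := by
  refine Lp.ext ?_
  filter_upwards [mulOneInf_ae (inclInf a b φ) ψ, mulOneInf_ae (inclInf a b ψ) φ, inclInf_ae φ,
    inclInf_ae ψ] with t h1 h2 h3 h4
  rw [h1, h2, h3, h4, mul_comm]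

/-- The pairing `∫_a^b φ g` of `L_∞` with `L_1`. -/
def pairing (a b : ℝ) : LInf a b →L[ℂ] LOne a b →L[ℂ] ℂ :=
  (ContinuousLinearMap.mul ℂ ℂ).lpPairing (volIcc a b) ⊤ 1

lemma pairing_apply (φ : LInf a b) (g : LOne a b) :
    pairing a b φ g = ∫ t in Icc a b, φ t * g t :=
  (ContinuousLinearMap.mul ℂ ℂ).lpPairing_eq_integral φ g

lemma integrable_LInf_mul (φ : LInf a b) (g : LOne a b) :
    Integrable (fun t => φ t * g t) (volIcc a b) := by
  refine (L1.integrable_coeFn (mulOneInf a b g φ)).congr ?_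
  filter_upwards [mulOneInf_ae g φ] with t ht
  rw [ht, mul_comm]

/-- The operator `(w, g) ↦ w + ∫_c^x g` from `ℂ × L_1` to `L_1`. -/
def affPrim (a b c : ℝ) : (ℂ × LOne a b) →L[ℂ] LOne a b := inclInf a b ∘L affPrimInf a b c

lemma affPrim_ae (c : ℝ) (p : ℂ × LOne a b) :
    affPrim a b c p =ᵐ[volIcc a b] fun x => p.1 + prim c p.2 x :=
  (inclInf_ae _).trans (affPrimInf_ae c p)

/-- The primitive as a functional on `L_1`. -/
def primL (a b c x : ℝ) : LOne a b →L[ℂ] ℂ :=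
  LinearMap.mkContinuous
    { toFun := fun g => prim c g x
      map_add' := fun g h => prim_add c g h x
      map_smul' := fun w g => prim_smul c w g x } 1 fun g => by
    simpa using norm_prim_le c g x

@[simp] lemma primL_apply (c x : ℝ) (g : LOne a b) : primL a b c x g = prim c g x := rfl

/-- The integral over `[a,b]` as a functional on `L_1`. -/
def integralL (a b : ℝ) : LOne a b →L[ℂ] ℂ := L1.integralCLM' ℂ

lemma integralL_apply (g : LOne a b) : integralL a b g = ∫ t in Icc a b, g t := by
  rw [integralL, ← L1.integral_eq', L1.integral_eq_integral]

/-- For `f = w + ∫_c^x g` the value `w = f(c)`, as a functional of the pair `(f, g)`. -/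
def initialValue (a b c : ℝ) : (LOne a b × LOne a b) →L[ℂ] ℂ :=
  ((b - a)⁻¹ : ℂ) • (integralL a b ∘L
    (ContinuousLinearMap.fst ℂ _ _ - affPrim a b c ∘L
      (ContinuousLinearMap.inr ℂ ℂ (LOne a b)) ∘L ContinuousLinearMap.snd ℂ _ _))

/-- Subtracting the primitive of `g` leaves the constant `w`, and its mean over `[a,b]` is `w`.
Taking a mean instead of a point value keeps the functional continuous on `L_1 × L_1`. -/
lemma initialValue_affPrim (hab : a < b) (c : ℝ) (w : ℂ) (g : LOne a b) :
    initialValue a b c (affPrim a b c (w, g), g) = w := by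
  have h : affPrim a b c (w, g) - affPrim a b c (0, g) = affPrim a b c (w, 0) := by
    rw [← map_sub]; simp
  have h' : affPrim a b c (w, 0) =ᵐ[volIcc a b] fun _ => w := by
    filter_upwards [affPrim_ae c (w, (0 : LOne a b))] with t ht
    have := norm_prim_le c (0 : LOne a b) t
    rw [norm_zero, norm_le_zero_iff] at this
    rw [ht]; simp [this]
  have hb : ((b : ℂ) - a) ≠ 0 := by
    rw [← Complex.ofReal_sub]; exact_mod_cast (sub_pos.2 hab).ne'
  simp only [initialValue, _root_.smul_apply, ContinuousLinearMap.comp_apply,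
    _root_.sub_apply, ContinuousLinearMap.coe_fst', ContinuousLinearMap.coe_snd',
    ContinuousLinearMap.inr_apply, h, integralL_apply]
  rw [integral_congr_ae h']
  simp [hab.le]
  field_simp

/-- This turns the existence of an absolutely continuous representative into an equation between
continuous operators. Closedness, hence completeness, of the Sobolev spaces follows from it. -/
lemma exists_isACPrimitive_iff (hab : a < b) {c : ℝ} (hc : c ∈ Icc a b) (f g : LOne a b) :
    (∃ F : ℝ → ℂ, IsACPrimitive a b F g ∧ f =ᵐ[volIcc a b] F) ↔
      f = affPrim a b c (initialValue a b c (f, g), g) := by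
  constructor
  · rintro ⟨F, hF, hf⟩
    have h : f = affPrim a b c (F c, g) := by
      refine Lp.ext ?_
      filter_upwards [hf, affPrim_ae c (F c, g), ae_restrict_mem measurableSet_Icc] with t h1 h2 h3
      rw [h1, h2, hF.eq_add_prim hab hc h3]
    have h2 := initialValue_affPrim hab c (F c) g
    rw [← h] at h2
    rw [h2]; exact h
  · intro h
    refine ⟨_, isACPrimitive_const_add_prim c (initialValue a b c (f, g)) g, ?_⟩
    nth_rw 1 [h]
    exact affPrim_ae c _

lemma IsACPrimitive.eq_initialValue (hab : a < b) {F : ℝ → ℂ} {f g : LOne a b}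
    (hF : IsACPrimitive a b F g) (hf : f =ᵐ[volIcc a b] F) {c : ℝ} (hc : c ∈ Icc a b) :
    F c = initialValue a b c (f, g) := by
  have h : f = affPrim a b c (F c, g) := by
    refine Lp.ext ?_
    filter_upwards [hf, affPrim_ae c (F c, g), ae_restrict_mem measurableSet_Icc] with t h1 h2 h3
    rw [h1, h2, hF.eq_add_prim hab hc h3]
  rw [h, initialValue_affPrim hab]

end LOperators

/-! ### Density of polynomials in `L_1`. -/

section Polynomials

variable {a b : ℝ}

lemma memLp_top_polynomial (a b : ℝ) (P : Polynomial ℂ) :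
    MemLp (fun t : ℝ => P.eval (t : ℂ)) ⊤ (volIcc a b) := by
  have hc : Continuous fun t : ℝ => P.eval (t : ℂ) := by fun_prop
  obtain ⟨C, hC⟩ := (isCompact_Icc (a := a) (b := b)).exists_bound_of_continuousOn hc.continuousOn
  exact memLp_top_of_bound hc.aestronglyMeasurable C
    ((ae_restrict_iff' measurableSet_Icc).2 (ae_of_all _ hC))

/-- A polynomial as an element of `L_∞([a,b])`. -/
def polyInf (a b : ℝ) (P : Polynomial ℂ) : LInf a b := (memLp_top_polynomial a b P).toLp

lemma polyInf_ae (P : Polynomial ℂ) :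
    polyInf a b P =ᵐ[volIcc a b] fun t => P.eval (t : ℂ) :=
  (memLp_top_polynomial a b P).coeFn_toLp

lemma exists_polynomial_near (f : ℝ → ℂ) (hf : Continuous f) (a b : ℝ) {δ : ℝ} (hδ : 0 < δ) :
    ∃ P : Polynomial ℂ, ∀ x ∈ Icc a b, ‖f x - P.eval (x : ℂ)‖ ≤ 2 * δ := by
  obtain ⟨p, hp⟩ := exists_polynomial_near_of_continuousOn a b (fun x => (f x).re)
    (Complex.continuous_re.comp hf).continuousOn δ hδ
  obtain ⟨q, hq⟩ := exists_polynomial_near_of_continuousOn a b (fun x => (f x).im)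
    (Complex.continuous_im.comp hf).continuousOn δ hδ
  refine ⟨p.map Complex.ofRealHom + Polynomial.C Complex.I * q.map Complex.ofRealHom,
    fun x hx => ?_⟩
  have e1 : ∀ r : Polynomial ℝ, (r.map Complex.ofRealHom).eval (x : ℂ) = ((r.eval x : ℝ) : ℂ) :=
    fun r => by
      rw [← Complex.ofRealHom_eq_coe, ← Complex.ofRealHom_eq_coe, Polynomial.eval_map_apply]
  have h1 := hp x hx
  have h2 := hq x hx
  refine (Complex.norm_le_abs_re_add_abs_im _).trans ?_
  simp only [Polynomial.eval_add, Polynomial.eval_mul, Polynomial.eval_C, e1]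
  simp only [Complex.sub_re, Complex.add_re, Complex.ofReal_re, Complex.mul_re, Complex.I_re,
    Complex.I_im, Complex.ofReal_im, Complex.sub_im, Complex.add_im, Complex.mul_im]
  rw [abs_sub_comm] at h1 h2
  ring_nf at h1 h2 ⊢
  linarith

lemma dense_polynomials (a b : ℝ) : DenseRange fun P => inclInf a b (polyInf a b P) := by
  rw [Metric.denseRange_iff]
  intro f ε hε
  obtain ⟨g, hg, hgi⟩ := (L1.integrable_coeFn f).exists_boundedContinuous_integral_sub_le
    (half_pos hε)
  set V : ℝ := (volIcc a b).real univ
  have hV : 0 ≤ V := measureReal_nonneg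
  -- The polynomial error is at most `2δ` (real and imaginary parts), so it contributes at most `2δV
  -- ≤ ε/4`. The summand 1 in `V + 1` covers the case `V = 0`.
  obtain ⟨P, hP⟩ := exists_polynomial_near g g.continuous a b
    (δ := ε / (8 * (V + 1))) (by positivity)
  refine ⟨P, ?_⟩
  rw [dist_eq_norm, L1.norm_eq_integral_norm]
  have h1 : ∀ᵐ t ∂(volIcc a b), ‖(f - inclInf a b (polyInf a b P) : LOne a b) t‖ ≤
      ‖f t - g t‖ + 2 * (ε / (8 * (V + 1))) := by
    filter_upwards [Lp.coeFn_sub f (inclInf a b (polyInf a b P)), inclInf_ae (polyInf a b P),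
      polyInf_ae (a := a) (b := b) P, ae_restrict_mem measurableSet_Icc] with t h1 h2 h3 h4
    rw [h1, Pi.sub_apply, h2, h3]
    exact (norm_sub_le_norm_sub_add_norm_sub _ (g t) _).trans (add_le_add le_rfl (hP t h4))
  have hi : Integrable (fun t => ‖f t - g t‖) (volIcc a b) :=
    ((L1.integrable_coeFn f).sub hgi).norm
  refine (integral_mono_ae (L1.integrable_coeFn _).norm (hi.add (integrable_const _)) h1).trans_lt ?_
  simp only [Pi.add_apply]
  rw [integral_add hi (integrable_const _), integral_const, smul_eq_mul]
  have h3 : V * (2 * (ε / (8 * (V + 1)))) < ε / 2 := by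
    rw [show V * (2 * (ε / (8 * (V + 1)))) = ε / 4 * (V / (V + 1)) by field_simp; ring]
    have : V / (V + 1) ≤ 1 := by rw [div_le_one (by positivity)]; linarith
    nlinarith
  linarith

end Polynomials

/-! ### Compactness of integration and of integration followed by multiplication. -/

section Compactness

variable {a b : ℝ}

/-- The indicator of `(x, y]` as an element of `L_∞([a,b])`. -/
def cellInf (a b x y : ℝ) : LInf a b :=
  indicatorConstLp ⊤ (measurableSet_Ioc : MeasurableSet (Ioc x y)) (measure_ne_top _ _) 1

lemma cellInf_ae (x y : ℝ) :
    cellInf a b x y =ᵐ[volIcc a b] (Ioc x y).indicator fun _ => (1 : ℂ) :=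
  indicatorConstLp_coeFn

lemma sum_indicator_Ioc {x : ℕ → ℝ} (hx : Monotone x) (N : ℕ) (t : ℝ) :
    ∑ i ∈ Finset.range N, (Ioc (x i) (x (i + 1))).indicator (fun _ => (1 : ℂ)) t =
      (Ioc (x 0) (x N)).indicator (fun _ => (1 : ℂ)) t := by
  have h : ∀ u v, u ≤ v → (Ioc u v).indicator (fun _ => (1 : ℂ)) t =
      (Iic v).indicator (fun _ => (1 : ℂ)) t - (Iic u).indicator (fun _ => (1 : ℂ)) t := by
    intro u v huv
    by_cases h1 : t ≤ u
    · simp [h1, h1.trans huv]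
    · by_cases h2 : t ≤ v <;> simp [h1, h2, not_le.1 h1]
  rw [h _ _ (hx (Nat.zero_le N)), Finset.sum_congr rfl fun i _ => h _ _ (hx (Nat.le_succ i))]
  exact Finset.sum_range_sub (fun i => (Iic (x i)).indicator (fun _ => (1 : ℂ)) t) N

/-- The operator `g ↦ ∫_c^x g` on `L_1`. -/
def volterra (a b c : ℝ) : LOne a b →L[ℂ] LOne a b :=
  affPrim a b c ∘L ContinuousLinearMap.inr ℂ ℂ (LOne a b)

lemma volterra_ae (c : ℝ) (g : LOne a b) : volterra a b c g =ᵐ[volIcc a b] prim c g := by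
  filter_upwards [affPrim_ae c ((0 : ℂ), g)] with t ht
  simpa [volterra] using ht

/-- On the cell the primitive departs from its value at the left end by at most the integral of
`|g|` over the cell; integrating this over the cell gives the factor `y - x`. -/
lemma norm_cell_volterra_sub_le (c : ℝ) (g : LOne a b) {x y : ℝ} (hxy : x ≤ y) :
    ‖mulOneInf a b (volterra a b c g) (cellInf a b x y) -
      prim c g x • inclInf a b (cellInf a b x y)‖ ≤
      (y - x) * (primNorm c g y - primNorm c g x) := by
  rw [L1.norm_eq_integral_norm]
  have hm := monotone_primNorm c g
  set K := primNorm c g y - primNorm c g x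
  have hK : 0 ≤ K := sub_nonneg.2 (hm hxy)
  have h : ∀ᵐ t ∂(volIcc a b), ‖(mulOneInf a b (volterra a b c g) (cellInf a b x y) -
      prim c g x • inclInf a b (cellInf a b x y) : LOne a b) t‖ ≤
      (Ioc x y).indicator (fun _ => K) t := by
    filter_upwards [Lp.coeFn_sub (mulOneInf a b (volterra a b c g) (cellInf a b x y))
      (prim c g x • inclInf a b (cellInf a b x y)),
      Lp.coeFn_smul (prim c g x) (inclInf a b (cellInf a b x y)),
      mulOneInf_ae (volterra a b c g) (cellInf a b x y), inclInf_ae (cellInf a b x y),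
      volterra_ae c g, cellInf_ae (a := a) (b := b) x y] with t h1 h2 h3 h4 h5 h6
    rw [h1, Pi.sub_apply, h2, Pi.smul_apply, h3, h4, h5, h6]
    by_cases ht : t ∈ Ioc x y
    · simp only [indicator_of_mem ht, mul_one, smul_eq_mul]
      refine (norm_prim_sub_le c c g x t).trans ?_
      rw [abs_of_nonneg (sub_nonneg.2 (hm ht.1.le))]
      exact sub_le_sub_right (hm ht.2) _
    · simp [indicator_of_notMem ht]
  refine (integral_mono_ae (L1.integrable_coeFn _).norm
    ((integrable_const K).indicator measurableSet_Ioc) h).trans ?_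
  rw [integral_indicator measurableSet_Ioc, Measure.restrict_restrict measurableSet_Ioc,
    setIntegral_const, smul_eq_mul]
  refine mul_le_mul_of_nonneg_right ?_ hK
  refine (measureReal_mono (inter_subset_left) (by simp)).trans ?_
  simp [hxy]

lemma isCompactOperator_rankOne {E F : Type*} [NormedAddCommGroup E] [NormedSpace ℂ E]
    [NormedAddCommGroup F] [NormedSpace ℂ F] (l : E →L[ℂ] ℂ) (v : F) :
    IsCompactOperator (l.smulRight v) := by
  have := (isCompactOperator_of_locallyCompactSpace_rng
    (ContinuousLinearMap.toSpanSingleton ℂ v)).comp_clm l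
  refine (congrArg IsCompactOperator ?_).mp this
  ext x; simp

lemma isCompactOperator_finsetSum {ι E F : Type*} [NormedAddCommGroup E] [NormedSpace ℂ E]
    [NormedAddCommGroup F] [NormedSpace ℂ F] (s : Finset ι) (f : ι → E →L[ℂ] F)
    (h : ∀ i ∈ s, IsCompactOperator (f i)) : IsCompactOperator (∑ i ∈ s, f i : E →L[ℂ] F) := by
  classical
  induction s using Finset.induction_on with
  | empty => simpa using isCompactOperator_zero
  | insert i s hi ih =>
    rw [Finset.sum_insert hi]
    exact (h i (by simp)).add (ih fun j hj => h j (by simp [hj]))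

/-- Freezing the primitive at the left ends of `N` equal cells gives a finite-rank operator. The
errors on the cells telescope to at most `d ‖g‖` with `d = (b - a) / N`, and compact operators are
closed in norm. -/
lemma isCompactOperator_volterra (hab : a < b) (c : ℝ) :
    IsCompactOperator (volterra a b c) := by
  have hcl := isClosed_setOfPred_isCompactOperator (𝕜₁ := ℂ) (σ₁₂ := RingHom.id ℂ) (M₁ := LOne a b)
    (M₂ := LOne a b)
  have h : volterra a b c ∈ closure {f : LOne a b →L[ℂ] LOne a b | IsCompactOperator f} := by
    rw [Metric.mem_closure_iff]
    intro ε hε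
    obtain ⟨N, hN⟩ := exists_nat_gt ((b - a) / ε)
    have hN0 : (0 : ℝ) < N := (div_pos (sub_pos.2 hab) hε).trans hN
    set d : ℝ := (b - a) / N
    have hd : 0 < d := div_pos (sub_pos.2 hab) hN0
    have hdε : d < ε := by
      rw [div_lt_iff₀ hN0]; rw [div_lt_iff₀ hε] at hN; linarith
    set x : ℕ → ℝ := fun i => a + i * d
    have hx : Monotone x := fun i j hij => by
      have : (i : ℝ) ≤ j := by exact_mod_cast hij
      simp only [x]; gcongr
    have hx0 : x 0 = a := by simp [x]
    have hxN : x N = b := by simp only [x, d]; field_simp; ring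
    refine ⟨∑ i ∈ Finset.range N,
      (primL a b c (x i)).smulRight (inclInf a b (cellInf a b (x i) (x (i + 1)))),
      isCompactOperator_finsetSum _ _ fun i _ => isCompactOperator_rankOne _ _, ?_⟩
    rw [dist_eq_norm]
    refine (ContinuousLinearMap.opNorm_le_bound _ hd.le fun g => ?_).trans_lt hdε
    have hsum : volterra a b c g = ∑ i ∈ Finset.range N,
        mulOneInf a b (volterra a b c g) (cellInf a b (x i) (x (i + 1))) := by
      rw [← map_sum]
      refine Lp.ext ?_
      -- The cells are open on the left, so together they cover `(a, b]` only.
      have hne : ∀ᵐ t ∂(volIcc a b), t ≠ a :=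
        ae_restrict_of_ae (by simp [ae_iff])
      have hs : ∀ᵐ t ∂(volIcc a b), (∑ i ∈ Finset.range N, cellInf a b (x i) (x (i + 1))
          : LInf a b) t = ∑ i ∈ Finset.range N, cellInf a b (x i) (x (i + 1)) t := by
        have := Lp.coeFn_finsetSum (Finset.range N) fun i => cellInf a b (x i) (x (i + 1))
        filter_upwards [this] with t ht
        rw [ht, Finset.sum_apply]
      have hc : ∀ᵐ t ∂(volIcc a b), ∀ i, cellInf a b (x i) (x (i + 1)) t =
          (Ioc (x i) (x (i + 1))).indicator (fun _ => (1 : ℂ)) t :=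
        ae_all_iff.2 fun i => cellInf_ae _ _
      filter_upwards [mulOneInf_ae (volterra a b c g)
        (∑ i ∈ Finset.range N, cellInf a b (x i) (x (i + 1))), hs, hc, hne,
        ae_restrict_mem measurableSet_Icc] with t h1 h2 h3 h4 h5
      rw [h1, h2, Finset.sum_congr rfl fun i _ => h3 i, sum_indicator_Ioc hx, hx0, hxN,
        indicator_of_mem (show t ∈ Ioc a b from ⟨lt_of_le_of_ne h5.1 (Ne.symm h4), h5.2⟩), mul_one]
    rw [_root_.sub_apply, hsum]
    simp only [_root_.sum_apply, ContinuousLinearMap.smulRight_apply, primL_apply]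
    rw [← Finset.sum_sub_distrib]
    refine (norm_sum_le _ _).trans ?_
    have hb : ∀ i ∈ Finset.range N,
        ‖mulOneInf a b (volterra a b c g) (cellInf a b (x i) (x (i + 1))) -
          prim c g (x i) • inclInf a b (cellInf a b (x i) (x (i + 1)))‖ ≤
        d * (primNorm c g (x (i + 1)) - primNorm c g (x i)) := fun i _ => by
      have := norm_cell_volterra_sub_le c g (hx (Nat.le_succ i))
      rwa [show x (i + 1) - x i = d by simp only [x]; push_cast; ring] at this
    refine (Finset.sum_le_sum hb).trans ?_
    rw [← Finset.mul_sum, Finset.sum_range_sub (fun i => primNorm c g (x i))]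
    exact mul_le_mul_of_nonneg_left (primNorm_sub_le c g (hx (Nat.zero_le N))) hd.le
  rwa [hcl.closure_eq] at h

/-- The operator depends norm continuously on `A ∈ L_1`, because the primitive is bounded into
`L_∞`; so polynomial `A` suffice. For those the product is a bounded multiplication on `L_1` applied
after the compact `volterra`. -/
lemma isCompactOperator_mul_prim (hab : a < b) (c : ℝ) (A : LOne a b) :
    IsCompactOperator (mulOneInf a b A ∘L affPrimInf a b c ∘L
      ContinuousLinearMap.inr ℂ ℂ (LOne a b)) := by
  have hcl := isClosed_setOfPred_isCompactOperator (𝕜₁ := ℂ) (σ₁₂ := RingHom.id ℂ) (M₁ := LOne a b)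
    (M₂ := LOne a b)
  have hcont : Continuous fun A : LOne a b => mulOneInf a b A ∘L affPrimInf a b c ∘L
      ContinuousLinearMap.inr ℂ ℂ (LOne a b) :=
    (mulOneInf a b).continuous.clm_comp continuous_const
  refine (dense_polynomials a b).induction_on (p := fun A => IsCompactOperator
    (mulOneInf a b A ∘L affPrimInf a b c ∘L ContinuousLinearMap.inr ℂ ℂ (LOne a b))) A
    (hcl.preimage hcont) fun P => ?_
  refine (congrArg IsCompactOperator ?_).mp
    ((isCompactOperator_volterra hab c).clm_comp ((mulOneInf a b).flip (polyInf a b P)))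
  funext g
  exact (mulOneInf_inclInf (polyInf a b P) (affPrimInf a b c (0, g))).symm

end Compactness

/-! ### Sobolev spaces: completeness, shifts and antiderivatives. -/

namespace Sob

variable {a b : ℝ} {k : ℕ}

/-- The derivative `y ↦ y^(s)` as a continuous operator. -/
def derL (a b : ℝ) (k : ℕ) (s : Fin (k + 1)) : Sob a b k →L[ℂ] LOne a b :=
  PiLp.proj 1 (fun _ : Fin (k + 1) => LOne a b) s ∘L (sobolevSubmodule a b k).subtypeL

lemma mem_iff (hab : a < b) {c : ℝ} (hc : c ∈ Icc a b)
    (u : PiLp 1 (fun _ : Fin (k + 1) => LOne a b)) :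
    u ∈ sobolevSubmodule a b k ↔ ∀ s : Fin k,
      u s.castSucc = affPrim a b c (initialValue a b c (u s.castSucc, u s.succ), u s.succ) :=
  forall_congr' fun _ => exists_isACPrimitive_iff hab hc _ _

lemma der_ext {y z : Sob a b k} (h : ∀ s, y.der s = z.der s) : y = z :=
  Subtype.ext (PiLp.ext h)

/-- The value `y^(s)(c)` as a functional. -/
def evL (a b c : ℝ) (k : ℕ) (s : Fin k) : Sob a b k →L[ℂ] ℂ :=
  initialValue a b c ∘L (derL a b k s.castSucc).prod (derL a b k s.succ)

lemma derAt_eq (hab : a < b) {c : ℝ} (hc : c ∈ Icc a b) (y : Sob a b k) (s : Fin k) :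
    y.derAt s c = evL a b c k s y :=
  (y.2 s).choose_spec.1.eq_initialValue hab (y.2 s).choose_spec.2 hc

lemma der_castSucc (hab : a < b) {c : ℝ} (hc : c ∈ Icc a b) (y : Sob a b k) (s : Fin k) :
    y.der s.castSucc = affPrim a b c (evL a b c k s y, y.der s.succ) :=
  (mem_iff hab hc y.1).1 y.2 s

lemma evL_eq_add_prim (hab : a < b) {c d : ℝ} (hc : c ∈ Icc a b) (hd : d ∈ Icc a b)
    (y : Sob a b k) (s : Fin k) :
    evL a b d k s y = evL a b c k s y + prim c (y.der s.succ) d := by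
  have h := (y.2 s).choose_spec.1.eq_add_prim hab hc hd
  rw [← derAt_eq hab hd, ← derAt_eq hab hc]
  exact h

lemma isClosed_sobolevSubmodule (hab : a < b) (k : ℕ) :
    IsClosed (sobolevSubmodule a b k : Set (PiLp 1 (fun _ : Fin (k + 1) => LOne a b))) := by
  have h : (sobolevSubmodule a b k : Set (PiLp 1 (fun _ : Fin (k + 1) => LOne a b))) =
      ⋂ s : Fin k, {u | u s.castSucc =
        affPrim a b a (initialValue a b a (u s.castSucc, u s.succ), u s.succ)} := by
    ext u
    rw [mem_iInter]
    exact mem_iff hab (left_mem_Icc.2 hab.le) u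
  rw [h]
  refine isClosed_iInter fun s => isClosed_eq ?_ ?_
  · exact (PiLp.proj (𝕜 := ℂ) 1 (fun _ : Fin (k + 1) => LOne a b) s.castSucc).continuous
  · have h1 := (PiLp.proj (𝕜 := ℂ) 1 (fun _ : Fin (k + 1) => LOne a b) s.castSucc).continuous
    have h2 := (PiLp.proj (𝕜 := ℂ) 1 (fun _ : Fin (k + 1) => LOne a b) s.succ).continuous
    exact (affPrim a b a).continuous.comp
      (((initialValue a b a).continuous.comp (h1.prodMk h2)).prodMk h2)

lemma completeSpace (hab : a < b) (k : ℕ) : CompleteSpace (Sob a b k) :=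
  (isClosed_sobolevSubmodule hab k).completeSpace_coe

/-- A continuous operator into `W_1^k` from its components. -/
def lift {E : Type*} [NormedAddCommGroup E] [NormedSpace ℂ E] (f : Fin (k + 1) → E →L[ℂ] LOne a b)
    (hf : ∀ x, WithLp.toLp 1 (fun i => f i x) ∈ sobolevSubmodule a b k) : E →L[ℂ] Sob a b k :=
  ((PiLp.continuousLinearEquiv 1 ℂ (fun _ : Fin (k + 1) => LOne a b)).symm.toContinuousLinearMap ∘L
    ContinuousLinearMap.pi f).codRestrict (sobolevSubmodule a b k) hf

/-- The element `y^(s)` of `W_1^j` for `y ∈ W_1^k` and `s + j ≤ k`. -/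
def shift (a b : ℝ) (k s j : ℕ) (h : s + j ≤ k) : Sob a b k →L[ℂ] Sob a b j :=
  lift (fun i => derL a b k ⟨s + i, by omega⟩) fun y i => y.2 ⟨s + i, by omega⟩

@[simp] lemma shift_der {s j : ℕ} (h : s + j ≤ k) (y : Sob a b k) (i : Fin (j + 1)) :
    (shift a b k s j h y).der i = y.der ⟨s + i, by omega⟩ := rfl

lemma evL_shift (c : ℝ) {s j : ℕ} (h : s + j ≤ k) (y : Sob a b k) (i : Fin j) :
    evL a b c j i (shift a b k s j h y) = evL a b c k ⟨s + i, by omega⟩ y := rfl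

/-- The identification of `L_1` with `W_1^0`. -/
def ofL1 (a b : ℝ) : LOne a b →L[ℂ] Sob a b 0 :=
  lift (fun _ => ContinuousLinearMap.id ℂ _) fun _ i => i.elim0

/-- The element `w + ∫_c^x z` of `W_1^(k+1)` for `w ∈ ℂ` and `z ∈ W_1^k`. -/
def antideriv (a b c : ℝ) (k : ℕ) : (ℂ × Sob a b k) →L[ℂ] Sob a b (k + 1) :=
  lift (Fin.cons
      (affPrim a b c ∘L (ContinuousLinearMap.fst ℂ _ _).prod
        (derL a b k 0 ∘L ContinuousLinearMap.snd ℂ _ _))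
      fun i => derL a b k i ∘L ContinuousLinearMap.snd ℂ _ _)
    fun p s => by
      refine Fin.cases ?_ (fun s => ?_) s
      · exact ⟨_, isACPrimitive_const_add_prim c p.1 (p.2.der 0), affPrim_ae c (p.1, p.2.der 0)⟩
      · exact p.2.2 s

@[simp] lemma antideriv_der_zero (c : ℝ) (p : ℂ × Sob a b k) :
    (antideriv a b c k p).der 0 = affPrim a b c (p.1, p.2.der 0) := rfl

@[simp] lemma antideriv_der_succ (c : ℝ) (p : ℂ × Sob a b k) (i : Fin (k + 1)) :
    (antideriv a b c k p).der i.succ = p.2.der i := rfl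

lemma shift_one_antideriv (c : ℝ) (p : ℂ × Sob a b k) :
    shift a b (k + 1) 1 k (by omega) (antideriv a b c k p) = p.2 := by
  refine der_ext fun s => ?_
  rw [shift_der, ← antideriv_der_succ c p s]
  congr 1; ext; simp [add_comm]

lemma evL_antideriv_zero (hab : a < b) (c : ℝ) (p : ℂ × Sob a b k) :
    evL a b c (k + 1) 0 (antideriv a b c k p) = p.1 :=
  initialValue_affPrim hab c p.1 (p.2.der 0)

lemma eq_antideriv (hab : a < b) {c : ℝ} (hc : c ∈ Icc a b) (y : Sob a b (k + 1)) :
    y = antideriv a b c k (evL a b c (k + 1) 0 y, shift a b (k + 1) 1 k (by omega) y) := by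
  refine der_ext fun s => ?_
  refine Fin.cases ?_ (fun s => ?_) s
  · rw [antideriv_der_zero]
    exact der_castSucc hab hc y 0
  · rw [antideriv_der_succ, shift_der]
    congr 1; ext; simp [add_comm]

/-- The derivative of an absolutely continuous representative is unique almost everywhere, so the
zeroth entry of the tuple determines the others one after another. -/
lemma ext_der_zero (hab : a < b) {y z : Sob a b k} (h : y.der 0 = z.der 0) : y = z := by
  induction k with
  | zero =>
    refine der_ext fun s => ?_
    rw [show s = 0 from Fin.ext (by have := s.2; omega), h]
  | succ k ih =>
    obtain ⟨F, hF, hFy⟩ := y.2 0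
    obtain ⟨G, hG, hGz⟩ := z.2 0
    have hyz : y.1 (Fin.castSucc 0) = z.1 (Fin.castSucc 0) := h
    have h1 : y.1 (Fin.succ 0) = z.1 (Fin.succ 0) :=
      hF.deriv_unique hab hG (hFy.symm.trans (hyz ▸ hGz))
    have hd : shift a b (k + 1) 1 k (by omega) y = shift a b (k + 1) 1 k (by omega) z := ih h1
    have he : evL a b a (k + 1) 0 y = evL a b a (k + 1) 0 z :=
      congrArg (initialValue a b a) (Prod.ext hyz h1)
    have ha : a ∈ Icc a b := left_mem_Icc.2 hab.le
    rw [eq_antideriv hab ha y, eq_antideriv hab ha z, hd, he]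

end Sob

/-! ### Products in Sobolev spaces, density of polynomials and the initial value problem. -/

lemma affPrim_mul_ae {a b : ℝ} (hab : a < b) {c : ℝ} (hc : c ∈ Icc a b) {f f' g g' q : LOne a b}
    (hf : ∃ F : ℝ → ℂ, IsACPrimitive a b F f' ∧ f =ᵐ[volIcc a b] F)
    (hg : ∃ G : ℝ → ℂ, IsACPrimitive a b G g' ∧ g =ᵐ[volIcc a b] G)
    (hq : q =ᵐ[volIcc a b] fun t => f' t * g t + f t * g' t) :
    affPrim a b c (initialValue a b c (f, f') * initialValue a b c (g, g'), q) =ᵐ[volIcc a b]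
      fun t => f t * g t := by
  obtain ⟨F, hF, hFf⟩ := hf
  obtain ⟨G, hG, hGg⟩ := hg
  -- Leibniz rule for absolutely continuous representatives: the product is then recovered from its
  -- value at `c` and its derivative `q`.
  have hFG : IsACPrimitive a b (fun t => F t * G t) q := by
    refine ⟨hF.1.smul hG.1, ?_⟩
    filter_upwards [hF.2, hG.2, hFf, hGg, hq] with t h1 h2 h3 h4 h5
    rw [h5, h3, h4]
    exact h1.mul h2
  rw [← hF.eq_initialValue hab hFf hc, ← hG.eq_initialValue hab hGg hc]
  filter_upwards [affPrim_ae c (F c * G c, q), hFf, hGg, ae_restrict_mem measurableSet_Icc]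
    with t h1 h2 h3 h4
  rw [h1, h2, h3, hFG.eq_add_prim hab hc h4]

/-- Serves the induction step of `Sob.exists_mul`, with `J` the antiderivative, `M₁` the derivative
of the product and `M₂` its initial value. The scalar-valued `M₂ x` never spoils compactness. -/
lemma exists_comp_bilinear {X Y E F : Type*} [NormedAddCommGroup X] [NormedSpace ℂ X]
    [NormedAddCommGroup Y] [NormedSpace ℂ Y] [NormedAddCommGroup E] [NormedSpace ℂ E]
    [NormedAddCommGroup F] [NormedSpace ℂ F] (J : (ℂ × E) →L[ℂ] F) (M₂ : X →L[ℂ] Y →L[ℂ] ℂ)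
    (M₁ : X →L[ℂ] Y →L[ℂ] E) : ∃ B : X →L[ℂ] Y →L[ℂ] F, (∀ x y, B x y = J (M₂ x y, M₁ x y)) ∧
      ∀ x, IsCompactOperator (M₁ x) → IsCompactOperator (B x) := by
  refine ⟨(ContinuousLinearMap.compL ℂ _ _ _ (J ∘L .inr ℂ ℂ E)) ∘L M₁ +
    (ContinuousLinearMap.compL ℂ _ _ _ (J ∘L .inl ℂ ℂ E)) ∘L M₂, fun x y => ?_, fun x hx => ?_⟩
  · change J (0, M₁ x y) + J (M₂ x y, 0) = _
    rw [← map_add]; simp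
  · exact (hx.clm_comp (J ∘L .inr ℂ ℂ E)).add
      ((isCompactOperator_of_locallyCompactSpace_dom (M₂ x)).clm_comp (J ∘L .inl ℂ ℂ E))

namespace Sob

variable {a b : ℝ} {k : ℕ}

/-- Induction through `(Ay)' = A'y + Ay'`: both terms are products one level lower, and `Ay` is
rebuilt from its derivative and its value at `a`. Compactness starts at level zero, where the spare
derivative of `y` makes it a constant plus a primitive. -/
lemma exists_mul (hab : a < b) (n : ℕ) :
    ∃ M : Sob a b n →L[ℂ] Sob a b (n + 1) →L[ℂ] Sob a b n,
      (∀ A y, (M A y).der 0 =ᵐ[volIcc a b] fun t => A.der 0 t * y.der 0 t) ∧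
      ∀ A, IsCompactOperator (M A) := by
  have ha : a ∈ Icc a b := left_mem_Icc.2 hab.le
  induction n with
  | zero =>
    let φ : Sob a b 1 →L[ℂ] LInf a b :=
      affPrimInf a b a ∘L (evL a b a 1 0).prod (derL a b 1 1)
    refine ⟨(ContinuousLinearMap.compL ℂ _ _ _ (ofL1 a b)) ∘L
      ((mulOneInf a b).bilinearComp (derL a b 0 0) φ), fun A y => ?_, fun A => ?_⟩
    · have h : y.der 0 = affPrim a b a (evL a b a 1 0 y, y.der 1) := der_castSucc hab ha y 0
      filter_upwards [mulOneInf_ae (A.der 0) (φ y), affPrim_ae a (evL a b a 1 0 y, y.der 1),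
        affPrimInf_ae a (evL a b a 1 0 y, y.der 1)] with t h1 h2 h3
      rw [h, h2, ← h3]
      exact h1
    · have h1 := (isCompactOperator_mul_prim hab a (A.der 0)).comp_clm (derL a b 1 1)
      have h2 := isCompactOperator_rankOne (evL a b a 1 0)
        (mulOneInf a b (A.der 0) (affPrimInf a b a (1, 0)))
      refine (congrArg IsCompactOperator ?_).mp ((h1.add h2).clm_comp (ofL1 a b))
      funext y
      refine congrArg (ofL1 a b) ?_
      -- The constant part of `y` contributes rank one; the primitive part falls under
      -- `isCompactOperator_mul_prim`.
      have : ((evL a b a 1 0 y, y.der 1) : ℂ × LOne a b) =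
          (0, y.der 1) + evL a b a 1 0 y • ((1, 0) : ℂ × LOne a b) := by simp
      change _ = mulOneInf a b (A.der 0) (affPrimInf a b a (evL a b a 1 0 y, y.der 1))
      rw [this, map_add, map_add, map_smul, map_smul]
      rfl
  | succ n ih =>
    obtain ⟨M, hM, hMc⟩ := ih
    let D := fun k => shift a b (k + 1) 1 k (by omega)
    let ι := fun k => shift a b (k + 1) 0 k (by omega)
    let M₁ := M.bilinearComp (D n) (ι (n + 1)) + M.bilinearComp (ι n) (D (n + 1))
    let M₂ := (ContinuousLinearMap.mul ℂ ℂ).bilinearComp (evL a b a (n + 1) 0)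
      (evL a b a (n + 2) 0)
    obtain ⟨B, hB, hBc⟩ := exists_comp_bilinear (antideriv a b a n) M₂ M₁
    refine ⟨B, fun A y => ?_, fun A => hBc A
      (((hMc (D n A)).comp_clm (ι (n + 1))).add ((hMc (ι n A)).comp_clm (D (n + 1))))⟩
    have h1 : (M₁ A y).der 0 = (M (D n A) (ι (n + 1) y)).der 0 +
      (M (ι n A) (D (n + 1) y)).der 0 := rfl
    have h2 := hM (D n A) (ι (n + 1) y)
    have h3 := hM (ι n A) (D (n + 1) y)
    have h4 : (M₁ A y).der 0 =ᵐ[volIcc a b]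
        fun t => A.der 1 t * y.der 0 t + A.der 0 t * y.der 1 t := by
      rw [h1]
      exact (Lp.coeFn_add _ _).trans (h2.add h3)
    rw [hB, antideriv_der_zero]
    exact affPrim_mul_ae hab ha (A.2 0) (y.2 0) h4

lemma isPolynomial_iff (y : Sob a b k) : y.IsPolynomial ↔
    ∃ P, y.der 0 = inclInf a b (polyInf a b P) := by
  refine exists_congr fun P => ⟨fun h => Lp.ext ?_, fun h => ?_⟩
  · exact h.trans ((inclInf_ae _).trans (polyInf_ae P)).symm
  · rw [h]; exact (inclInf_ae _).trans (polyInf_ae P)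

lemma exists_polynomial_antideriv (P : Polynomial ℂ) (w c : ℂ) :
    ∃ Q : Polynomial ℂ, Q.derivative = P ∧ Q.eval c = w := by
  obtain ⟨Q, hQ⟩ : ∃ Q : Polynomial ℂ, Q.derivative = P := by
    induction P using Polynomial.induction_on' with
    | add p q hp hq =>
      obtain ⟨p', rfl⟩ := hp
      obtain ⟨q', rfl⟩ := hq
      exact ⟨p' + q', map_add _ _ _⟩
    | monomial n x =>
      have hn : (n : ℂ) + 1 ≠ 0 := Nat.cast_add_one_ne_zero n
      refine ⟨Polynomial.monomial (n + 1) (x / (n + 1)), ?_⟩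
      rw [Polynomial.derivative_monomial]
      simp [div_mul_cancel₀ _ hn]
  exact ⟨Q + Polynomial.C (w - Q.eval c), by simp [hQ], by simp⟩

lemma isPolynomial_antideriv (hab : a < b) {z : Sob a b k} (hz : z.IsPolynomial) (w : ℂ) :
    (antideriv a b a k (w, z)).IsPolynomial := by
  obtain ⟨P, hP⟩ := hz
  obtain ⟨Q, hQ, hQa⟩ := exists_polynomial_antideriv P w a
  refine ⟨Q, ?_⟩
  have hACP : IsACPrimitive a b (fun t => Q.eval (t : ℂ)) (z.der 0) := by
    have hd : ∀ t : ℝ, HasDerivAt (fun t : ℝ => Q.eval (t : ℂ)) (P.eval (t : ℂ)) t := fun t => by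
      rw [← hQ]
      exact (Q.hasDerivAt (t : ℂ)).comp_ofReal
    refine ⟨ContDiffOn.absolutelyContinuousOnInterval (ContDiff.contDiffOn ?_), ?_⟩
    · exact contDiff_one_iff_deriv.2 ⟨fun t => (hd t).differentiableAt, by
        rw [show deriv (fun t : ℝ => Q.eval (t : ℂ)) = fun t : ℝ => P.eval (t : ℂ) from
          funext fun t => (hd t).deriv]
        fun_prop⟩
    · filter_upwards [hP] with t ht
      rw [ht]; exact hd t
  rw [antideriv_der_zero]
  filter_upwards [affPrim_ae a (w, z.der 0), ae_restrict_mem measurableSet_Icc] with t h1 h2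
  rw [h1, hACP.eq_add_prim hab (left_mem_Icc.2 hab.le) h2, hQa]

/-- The antiderivative map is continuous and onto and preserves polynomials, so density climbs from
`L_1` one level at a time. -/
lemma dense_isPolynomial (hab : a < b) (k : ℕ) : Dense {y : Sob a b k | y.IsPolynomial} := by
  induction k with
  | zero =>
    have hs : Function.Surjective (ofL1 a b) := fun y => ⟨y.der 0, ext_der_zero hab rfl⟩
    refine (hs.denseRange.comp (dense_polynomials a b) (ofL1 a b).continuous).mono ?_
    rintro _ ⟨P, rfl⟩
    exact (isPolynomial_iff _).2 ⟨P, rfl⟩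
  | succ k ih =>
    have hs : Function.Surjective (antideriv a b a k) := fun y =>
      ⟨_, (eq_antideriv hab (left_mem_Icc.2 hab.le) y).symm⟩
    refine (hs.denseRange.dense_image (antideriv a b a k).continuous
      (dense_univ.prod ih)).mono ?_
    rintro _ ⟨⟨w, z⟩, ⟨-, hz⟩, rfl⟩
    exact isPolynomial_antideriv hab hz w

lemma evL_shift_one (c : ℝ) (y : Sob a b (k + 1)) (i : Fin k) :
    evL a b c k i (shift a b (k + 1) 1 k (by omega) y) = evL a b c (k + 1) i.succ y := by
  rw [evL_shift]
  exact congrArg (fun i => evL a b c (k + 1) i y) (Fin.ext (add_comm 1 (i : ℕ)))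

/-- Solves the model problem with `y^(r)` and the first `r` initial values prescribed: integrate
once for each prescribed value. -/
lemma exists_unique_derivative_initial (hab : a < b) {c : ℝ} (hc : c ∈ Icc a b) (n r : ℕ)
    (z : Sob a b n) (w : Fin r → ℂ) :
    ∃! y : Sob a b (n + r), shift a b (n + r) r n (by omega) y = z ∧
      ∀ s : Fin r, evL a b c (n + r) ⟨s, by omega⟩ y = w s := by
  induction r with
  | zero =>
    refine ⟨z, ⟨?_, fun s => s.elim0⟩, fun y hy => ?_⟩
    · exact ext_der_zero hab rfl
    · rw [← hy.1]; exact ext_der_zero hab rfl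
  | succ r ih =>
    obtain ⟨y, ⟨hy1, hy2⟩, hyu⟩ := ih fun s => w s.succ
    have hsh : ∀ u : Sob a b (n + r + 1),
        shift a b (n + r) r n (by omega) (shift a b (n + r + 1) 1 (n + r) (by omega) u) =
        shift a b (n + (r + 1)) (r + 1) n (by omega) u := fun u => by
      refine der_ext fun s => ?_
      simp only [shift_der]
      congr 1; ext; simp; omega
    refine ⟨antideriv a b c (n + r) (w 0, y), ⟨?_, fun s => ?_⟩, fun u hu => ?_⟩
    · rw [← hsh, shift_one_antideriv, hy1]
    · refine Fin.cases ?_ (fun s => ?_) s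
      · exact evL_antideriv_zero hab c _
      · exact hy2 s
    · refine (eq_antideriv hab hc u).trans (congrArg _ (Prod.ext (hu.2 0) (hyu _ ⟨?_, fun s => ?_⟩)))
      · rw [← hu.1, ← hsh]; rfl
      · exact (evL_shift_one c u _).trans (hu.2 s.succ)

/-- The element of `W_1^k` with the highest derivative `g` and vanishing lower derivatives at `c`. -/
lemma exists_primitive (hab : a < b) {c : ℝ} (k : ℕ) :
    ∃ R : LOne a b →L[ℂ] Sob a b k, ∀ g, (R g).der (Fin.last k) = g ∧
      ∀ s, evL a b c k s (R g) = 0 := by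
  induction k with
  | zero => exact ⟨ofL1 a b, fun g => ⟨rfl, fun s => s.elim0⟩⟩
  | succ k ih =>
    obtain ⟨R, hR⟩ := ih
    refine ⟨antideriv a b c k ∘L ContinuousLinearMap.inr ℂ ℂ _ ∘L R, fun g => ⟨(hR g).1, fun s => ?_⟩⟩
    refine Fin.cases ?_ (fun s => ?_) s
    · exact evL_antideriv_zero hab c _
    · exact (hR g).2 s

end Sob

/-! ### Step functions in `L_∞` and approximation of regulated functions. -/

section Steps

variable {a b : ℝ}

/-- The bridge between the two kinds of boundary operators: for `g = y^(n+r)` the right side is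
`y^(n+r-1)(x) - y^(n+r-1)(a)`. -/
lemma pairing_cellInf {x : ℝ} (hx : x ∈ Icc a b) (g : LOne a b) :
    pairing a b (cellInf a b a x) g = prim a g x := by
  rw [pairing_apply, prim, intervalIntegral.integral_of_le hx.1, setIntegral_indicator
    measurableSet_Icc, inter_eq_left.2 (Ioc_subset_Icc_self.trans (Icc_subset_Icc_right hx.2))]
  have h : (fun t => cellInf a b a x t * g t) =ᵐ[volIcc a b]
      (Ioc a x).indicator (g : ℝ → ℂ) := by
    filter_upwards [cellInf_ae (a := a) (b := b) a x] with t ht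
    rw [ht]
    by_cases hm : t ∈ Ioc a x <;> simp [hm]
  rw [integral_congr_ae h, setIntegral_indicator measurableSet_Ioc,
    inter_eq_right.2 (Ioc_subset_Icc_self.trans (Icc_subset_Icc_right hx.2))]

lemma cellInf_ae_Iio (x : ℝ) :
    cellInf a b a x =ᵐ[volIcc a b] (Iio x).indicator fun _ => (1 : ℂ) := by
  have hne : ∀ᵐ t ∂(volIcc a b), t ≠ a ∧ t ≠ x :=
    ae_restrict_of_ae ((by simp [ae_iff] : ∀ᵐ t, t ≠ a).and (by simp [ae_iff]))
  filter_upwards [cellInf_ae (a := a) (b := b) a x, hne, ae_restrict_mem measurableSet_Icc]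
    with t h1 h2 h3
  rw [h1]
  have h4 : a < t := lt_of_le_of_ne h3.1 (Ne.symm h2.1)
  by_cases h : t < x
  · rw [indicator_of_mem (show t ∈ Ioc a x from ⟨h4, h.le⟩), indicator_of_mem (show t ∈ Iio x from h)]
  · rw [indicator_of_notMem (show t ∉ Iio x from h),
      indicator_of_notMem fun h' => h (lt_of_le_of_ne h'.2 h2.2)]

lemma pairing_injective {φ ψ : LInf a b} (h : pairing a b φ = pairing a b ψ) : φ = ψ := by
  have hi : ∀ φ : LInf a b, Integrable φ (volIcc a b) := fun φ =>
    (L1.integrable_coeFn (inclInf a b φ)).congr (inclInf_ae φ)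
  refine Lp.ext ((hi φ).ae_eq_of_forall_setIntegral_eq _ _ (hi ψ) fun s hs _ => ?_)
  have key : ∀ φ : LInf a b, ∫ t in s, φ t ∂(volIcc a b) =
      pairing a b φ (indicatorConstLp 1 hs (measure_ne_top _ _) 1) := fun φ => by
    rw [pairing_apply, ← integral_indicator hs]
    refine integral_congr_ae ?_
    filter_upwards [indicatorConstLp_coeFn (p := 1) (μ := volIcc a b) (hs := hs)
      (hμs := measure_ne_top _ _) (c := (1 : ℂ))] with t ht
    rw [ht]
    by_cases hm : t ∈ s <;> simp [hm]
  rw [key, key, h]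

/-- The span of the indicators of the intervals `(a, x]` in `L_∞([a,b])`. -/
def stepSpan (a b : ℝ) : Submodule ℂ (LInf a b) :=
  Submodule.span ℂ ((fun x => cellInf a b a x) '' Icc a b)

lemma cellInf_mem_stepSpan {x y : ℝ} (hx : x ∈ Icc a b) (hy : y ∈ Icc a b) (hxy : x ≤ y) :
    cellInf a b x y ∈ stepSpan a b := by
  have h : cellInf a b x y = cellInf a b a y - cellInf a b a x := by
    refine Lp.ext ?_
    filter_upwards [cellInf_ae (a := a) (b := b) x y, cellInf_ae (a := a) (b := b) a y,
      cellInf_ae (a := a) (b := b) a x, Lp.coeFn_sub (cellInf a b a y) (cellInf a b a x)]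
      with t h1 h2 h3 h4
    rw [h4, Pi.sub_apply, h1, h2, h3]
    by_cases h5 : t ≤ a
    · simp [h5, h5.trans hx.1]
    · by_cases h6 : t ≤ x
      · simp [not_le.1 h5, h6, h6.trans hxy]
      · by_cases h7 : t ≤ y <;> simp [not_le.1 h5, not_le.1 h6, h6, h7]
  rw [h]
  exact sub_mem (Submodule.subset_span ⟨y, hy, rfl⟩) (Submodule.subset_span ⟨x, hx, rfl⟩)

/-- A function can be approximated with accuracy `ε` by a step function on `(x, y]`. -/
def StepApprox (a b : ℝ) (φ : ℝ → ℂ) (ε x y : ℝ) : Prop :=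
  ∃ S ∈ stepSpan a b, (∀ᵐ t ∂(volIcc a b), t ∉ Ioc x y → S t = 0) ∧
    ∀ᵐ t ∂(volIcc a b), t ∈ Ioc x y → ‖φ t - S t‖ ≤ ε

/-- Each step function vanishes off its own interval, so their sum agrees with the right one on each
piece. -/
lemma StepApprox.trans {φ : ℝ → ℂ} {ε x y z : ℝ} (hxy : x ≤ y) (hyz : y ≤ z)
    (h₁ : StepApprox a b φ ε x y) (h₂ : StepApprox a b φ ε y z) : StepApprox a b φ ε x z := by
  obtain ⟨S, hS, hS0, hSφ⟩ := h₁
  obtain ⟨S', hS', hS'0, hS'φ⟩ := h₂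
  refine ⟨S + S', add_mem hS hS', ?_, ?_⟩
  · filter_upwards [Lp.coeFn_add S S', hS0, hS'0] with t h1 h2 h3 h4
    rw [h1, Pi.add_apply, h2 fun h => h4 ⟨h.1, h.2.trans hyz⟩,
      h3 fun h => h4 ⟨hxy.trans_lt h.1, h.2⟩, add_zero]
  · filter_upwards [Lp.coeFn_add S S', hS0, hS'0, hSφ, hS'φ] with t h1 h2 h3 h4 h5 h6
    rw [h1, Pi.add_apply]
    by_cases h7 : t ≤ y
    · rw [h3 fun h => absurd h7 (not_le.2 h.1), add_zero]
      exact h4 ⟨h6.1, h7⟩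
    · rw [h2 fun h => h7 h.2, zero_add]
      exact h5 ⟨not_le.1 h7, h6.2⟩

lemma StepApprox.of_const {φ : ℝ → ℂ} {ε x y : ℝ} (hx : x ∈ Icc a b) (hy : y ∈ Icc a b)
    (hxy : x ≤ y) (l : ℂ) (h : ∀ t ∈ Ioo x y, ‖φ t - l‖ ≤ ε) : StepApprox a b φ ε x y := by
  refine ⟨l • cellInf a b x y, Submodule.smul_mem _ _ (cellInf_mem_stepSpan hx hy hxy), ?_, ?_⟩
  · filter_upwards [Lp.coeFn_smul l (cellInf a b x y), cellInf_ae (a := a) (b := b) x y]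
      with t h1 h2 h3
    rw [h1, Pi.smul_apply, h2, indicator_of_notMem h3, smul_zero]
  · have hne : ∀ᵐ t ∂(volIcc a b), t ≠ y := ae_restrict_of_ae (by simp [ae_iff])
    filter_upwards [Lp.coeFn_smul l (cellInf a b x y), cellInf_ae (a := a) (b := b) x y, hne]
      with t h1 h2 h3 h4
    rw [h1, Pi.smul_apply, h2, indicator_of_mem h4, smul_eq_mul, mul_one]
    exact h t ⟨h4.1, lt_of_le_of_ne h4.2 h3⟩

/-- Near `z` the function is `ε`-close to its right limit on the right and to its left limit on the
left. The value at `z` itself is negligible, so an interval containing `z` is split there. -/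
lemma StepApprox.of_local {φ : ℝ → ℂ} (hφ : IsRegulatedOn a b φ) {ε : ℝ} (hε : 0 < ε) {z : ℝ}
    (hz : z ∈ Icc a b) : ∃ δ > 0, ∀ x ∈ Icc a b, ∀ y ∈ Icc a b, x ≤ y → z - δ < x → y < z + δ →
      StepApprox a b φ ε x y := by
  -- The condition `z < b` stands inside the existential so that dummy values of `δ` and `l` serve
  -- at the endpoint; likewise `a < z` on the left.
  have hr : ∃ δ > 0, ∃ l : ℂ, z < b → ∀ t ∈ Ioo z (z + δ), ‖φ t - l‖ ≤ ε := by
    by_cases h : z < b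
    · obtain ⟨l, hl⟩ := hφ.1 z ⟨hz.1, h⟩
      have h2 := hl.eventually (Metric.closedBall_mem_nhds l hε)
      obtain ⟨u, hu, hu2⟩ := mem_nhdsGT_iff_exists_Ioo_subset.1 h2
      refine ⟨u - z, sub_pos.2 hu, l, fun _ t ht => ?_⟩
      rw [← dist_eq_norm]
      exact hu2 ⟨ht.1, by linarith [ht.2]⟩
    · exact ⟨1, one_pos, 0, fun h' => absurd h' h⟩
  have hl : ∃ δ > 0, ∃ l : ℂ, a < z → ∀ t ∈ Ioo (z - δ) z, ‖φ t - l‖ ≤ ε := by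
    by_cases h : a < z
    · obtain ⟨l, hl⟩ := hφ.2 z ⟨h, hz.2⟩
      have h2 := hl.eventually (Metric.closedBall_mem_nhds l hε)
      obtain ⟨u, hu, hu2⟩ := mem_nhdsLT_iff_exists_Ioo_subset.1 h2
      refine ⟨z - u, sub_pos.2 hu, l, fun _ t ht => ?_⟩
      rw [← dist_eq_norm]
      exact hu2 ⟨by linarith [ht.1], ht.2⟩
    · exact ⟨1, one_pos, 0, fun h' => absurd h' h⟩
  obtain ⟨δ₁, hδ₁, l₁, h₁⟩ := hr
  obtain ⟨δ₂, hδ₂, l₂, h₂⟩ := hl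
  refine ⟨min δ₁ δ₂, lt_min hδ₁ hδ₂, fun x hx y hy hxy hzx hyz => ?_⟩
  have hR : ∀ u ∈ Icc a b, u ≤ y → z ≤ u → StepApprox a b φ ε u y := fun u hu huy hzu => by
    refine .of_const hu hy huy l₁ fun t ht => h₁ ?_ t ⟨?_, ?_⟩
    · linarith [ht.1, ht.2, hy.2]
    · linarith [ht.1]
    · linarith [ht.2, min_le_left δ₁ δ₂]
  have hL : ∀ u ∈ Icc a b, x ≤ u → u ≤ z → StepApprox a b φ ε x u := fun u hu hxu huz => by
    refine .of_const hx hu hxu l₂ fun t ht => h₂ ?_ t ⟨?_, ?_⟩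
    · linarith [ht.1, ht.2, hx.1]
    · linarith [ht.1, min_le_right δ₁ δ₂]
    · linarith [ht.2]
  rcases le_total z x with h | h
  · exact hR x hx hxy h
  · rcases le_total y z with h' | h'
    · exact hL y hy hxy h'
    · exact (hL z hz h le_rfl).trans h h' (hR z hz h' le_rfl)

/-- By compactness there is a finite partition each of whose cells lies in one of the neighbourhoods
of `of_local`; the local approximations are glued along it. -/
lemma StepApprox.of_isRegulatedOn (hab : a < b) {φ : ℝ → ℂ} (hφ : IsRegulatedOn a b φ) {ε : ℝ}
    (hε : 0 < ε) : StepApprox a b φ ε a b := by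
  have H := fun z : Icc a b => StepApprox.of_local hφ hε z.2
  choose δ hδ H using H
  obtain ⟨t, ht0, htm, ⟨N, hN⟩, ht⟩ := exists_monotone_Icc_subset_open_cover_Icc hab.le
    (c := fun z : Icc a b => {x | (x : ℝ) ∈ Ioo ((z : ℝ) - δ z) (z + δ z)})
    (fun z => isOpen_Ioo.preimage continuous_subtype_val)
    (fun z _ => mem_iUnion.2 ⟨z, by simp [hδ z]⟩)
  have key : ∀ i : ℕ, StepApprox a b φ ε a (t i) := fun i => by
    induction i with
    | zero =>
      rw [ht0]
      exact .of_const (left_mem_Icc.2 hab.le) (left_mem_Icc.2 hab.le) le_rfl 0 fun t ht => by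
        simp at ht
    | succ i ih =>
      obtain ⟨z, hz⟩ := ht i
      have hle : t i ≤ t (i + 1) := htm (Nat.le_succ i)
      exact ih.trans (t i).2.1 hle (H z _ (t i).2 _ (t (i + 1)).2 hle
        (hz (left_mem_Icc.2 hle)).1 (hz (right_mem_Icc.2 hle)).2)
  have := key N
  rwa [hN N le_rfl] at this

lemma mem_closure_stepSpan (hab : a < b) {Φ : LInf a b} {φ : ℝ → ℂ} (hφ : IsRegulatedOn a b φ)
    (hΦ : Φ =ᵐ[volIcc a b] φ) : Φ ∈ closure (stepSpan a b : Set (LInf a b)) := by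
  rw [Metric.mem_closure_iff]
  intro ε hε
  obtain ⟨S, hS, -, hSφ⟩ := StepApprox.of_isRegulatedOn hab hφ (half_pos hε)
  refine ⟨S, hS, lt_of_le_of_lt ?_ (half_lt_self hε)⟩
  rw [dist_eq_norm]
  have h : ∀ᵐ t ∂(volIcc a b), ‖(Φ - S : LInf a b) t‖ ≤ ε / 2 := by
    have hne : ∀ᵐ t ∂(volIcc a b), t ≠ a := ae_restrict_of_ae (by simp [ae_iff])
    filter_upwards [hΦ, hSφ, Lp.coeFn_sub Φ S, hne, ae_restrict_mem measurableSet_Icc]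
      with t h1 h2 h3 h4 h5
    rw [h3, Pi.sub_apply, h1]
    exact h2 ⟨lt_of_le_of_ne h5.1 (Ne.symm h4), h5.2⟩
  have h2 := Lp.norm_le_of_ae_bound (half_pos hε).le h
  simpa only [ENNReal.toReal_top, inv_zero, one_mul, Real.rpow_zero] using h2

end Steps

/-! ### Norm limits of step functionals are given by regulated functions. -/

section Regulated

variable {a b : ℝ}

/-- Interchange of limits: a uniform limit of functions convergent along `F` is Cauchy along `F`. -/
lemma exists_tendsto_of_uniform_approx {F : Filter ℝ} [NeBot F] {s : Set ℝ} (hs : s ∈ F)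
    {φ : ℝ → ℂ} {σ : ℕ → ℝ → ℂ} {ε : ℕ → ℝ} (hε : Tendsto ε atTop (𝓝 0))
    (h : ∀ k, ∀ t ∈ s, ‖σ k t - φ t‖ ≤ ε k) (hσ : ∀ k, ∃ l, Tendsto (σ k) F (𝓝 l)) :
    ∃ l, Tendsto φ F (𝓝 l) := by
  rw [← cauchy_map_iff_exists_tendsto, Metric.cauchy_iff]
  refine ⟨inferInstance, fun η hη => ?_⟩
  obtain ⟨k, hk⟩ := (hε.eventually (gt_mem_nhds (show 0 < η / 4 by positivity))).exists
  obtain ⟨l, hl⟩ := hσ k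
  have h1 := hl.eventually (Metric.ball_mem_nhds l (show 0 < η / 4 by positivity))
  refine ⟨φ '' {t | t ∈ s ∧ σ k t ∈ Metric.ball l (η / 4)}, image_mem_map (inter_mem hs h1), ?_⟩
  have hb : ∀ t, t ∈ s ∧ σ k t ∈ Metric.ball l (η / 4) → dist (φ t) l < η / 2 := fun t ht => by
    have h2 := h k t ht.1
    rw [← dist_eq_norm, dist_comm] at h2
    have h3 := Metric.mem_ball.1 ht.2
    linarith [dist_triangle (φ t) (σ k t) l]
  rintro _ ⟨t, ht, rfl⟩ _ ⟨t', ht', rfl⟩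
  have := dist_triangle_right (φ t) (φ t') l
  linarith [hb t ht, hb t' ht']

/-- The step function `∑ β_p (1_{t < x_p} - 1_{t < c})`. -/
def stepFun {ι : Type*} [Fintype ι] (c : ℝ) (β : ι → ℂ) (x : ι → ℝ) (t : ℝ) : ℂ :=
  ∑ p, β p * ((Iio (x p)).indicator (fun _ => (1 : ℂ)) t - (Iio c).indicator (fun _ => (1 : ℂ)) t)

lemma exists_tendsto_indicator_Iio (x t : ℝ) :
    (∃ l, Tendsto ((Iio x).indicator fun _ => (1 : ℂ)) (𝓝[>] t) (𝓝 l)) ∧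
    ∃ l, Tendsto ((Iio x).indicator fun _ => (1 : ℂ)) (𝓝[<] t) (𝓝 l) := by
  constructor
  · rcases lt_or_ge t x with h | h
    · refine ⟨1, tendsto_const_nhds.congr' ?_⟩
      filter_upwards [Ioo_mem_nhdsGT h] with s hs
      rw [indicator_of_mem (show s ∈ Iio x from hs.2)]
    · refine ⟨0, tendsto_const_nhds.congr' ?_⟩
      filter_upwards [self_mem_nhdsWithin] with s hs
      rw [indicator_of_notMem (show s ∉ Iio x from not_lt.2 (h.trans (le_of_lt hs)))]
  · rcases lt_or_ge x t with h | h
    · refine ⟨0, tendsto_const_nhds.congr' ?_⟩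
      filter_upwards [Ioo_mem_nhdsLT h] with s hs
      rw [indicator_of_notMem (show s ∉ Iio x from not_lt.2 hs.1.le)]
    · refine ⟨1, tendsto_const_nhds.congr' ?_⟩
      filter_upwards [self_mem_nhdsWithin] with s hs
      rw [indicator_of_mem (show s ∈ Iio x from lt_of_lt_of_le hs h)]

lemma exists_tendsto_stepFun {ι : Type*} [Fintype ι] (c : ℝ) (β : ι → ℂ) (x : ι → ℝ) {F : Filter ℝ}
    (h : ∀ x, ∃ l, Tendsto ((Iio x).indicator fun _ => (1 : ℂ)) F (𝓝 l)) :
    ∃ l, Tendsto (stepFun c β x) F (𝓝 l) := by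
  choose l hl using h
  exact ⟨_, tendsto_finsetSum _ fun p _ => ((hl (x p)).sub (hl c)).const_mul (β p)⟩

lemma prim_inclInf_cellInf {t u x : ℝ} (hx : x ∈ Icc a b) :
    prim a (inclInf a b (cellInf a b t u)) x = ((volIcc a b).real (Ioc a x ∩ Ioc t u) : ℂ) := by
  rw [← pairing_cellInf hx, pairing_apply]
  have h : (fun s => cellInf a b a x s * inclInf a b (cellInf a b t u) s) =ᵐ[volIcc a b]
      (Ioc a x ∩ Ioc t u).indicator fun _ => (1 : ℂ) := by
    filter_upwards [inclInf_ae (cellInf a b t u), cellInf_ae (a := a) (b := b) t u,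
      cellInf_ae (a := a) (b := b) a x] with s h1 h2 h3
    rw [h1, h2, h3, ← inter_indicator_mul, one_mul]
  rw [integral_congr_ae h, integral_indicator (measurableSet_Ioc.inter measurableSet_Ioc),
    setIntegral_const]
  simp

/-- For small `h` the interval `(t, t+h]` lies inside `(a, x]` or misses it, so the identity is
exact. Intervals to the right of `t` single out the right-continuous indicator of `t < x`. -/
lemma eventually_prim_inclInf_cellInf {t x : ℝ} (ht : t ∈ Ico a b) (hx : x ∈ Icc a b) :
    ∀ᶠ h in 𝓝[>] (0 : ℝ), prim a (inclInf a b (cellInf a b t (t + h))) x =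
      h * (Iio x).indicator (fun _ => (1 : ℂ)) t := by
  rcases le_or_gt x t with hxt | hxt
  · filter_upwards with h
    rw [prim_inclInf_cellInf hx, indicator_of_notMem (show t ∉ Iio x from not_lt.2 hxt)]
    have : Ioc a x ∩ Ioc t (t + h) = ∅ := by
      ext s; simp only [mem_inter_iff, mem_Ioc, mem_empty_iff_false]; 
      rw [iff_false]; intro hs; linarith [hs.1.2, hs.2.1]
    simp [this]
  · filter_upwards [Ioo_mem_nhdsGT (sub_pos.2 hxt)] with h hh
    rw [prim_inclInf_cellInf hx, indicator_of_mem (show t ∈ Iio x from hxt)]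
    have h1 : Ioc a x ∩ Ioc t (t + h) = Ioc t (t + h) := by
      refine inter_eq_right.2 (Ioc_subset_Ioc ht.1 ?_)
      linarith [hh.2]
    have h2 : Ioc t (t + h) ∩ Icc a b = Ioc t (t + h) := by
      refine inter_eq_left.2 (Ioc_subset_Icc_self.trans (Icc_subset_Icc ht.1 ?_))
      linarith [hh.2, hx.2]
    rw [h1, measureReal_def, Measure.restrict_apply measurableSet_Ioc, h2, Real.volume_Ioc]
    simp [hh.1.le]

lemma norm_inclInf_cellInf_le {t h : ℝ} (hh : 0 ≤ h) :
    ‖inclInf a b (cellInf a b t (t + h))‖ ≤ h := by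
  rw [L1.norm_eq_integral_norm]
  have hc : ∀ᵐ s ∂(volIcc a b), ‖inclInf a b (cellInf a b t (t + h)) s‖ =
      (Ioc t (t + h)).indicator (fun _ => (1 : ℝ)) s := by
    filter_upwards [inclInf_ae (cellInf a b t (t + h)), cellInf_ae (a := a) (b := b) t (t + h)]
      with s h1 h2
    rw [h1, h2]
    by_cases hs : s ∈ Ioc t (t + h) <;> simp [hs]
  rw [integral_congr_ae hc, integral_indicator measurableSet_Ioc,
    Measure.restrict_restrict measurableSet_Ioc, setIntegral_const, smul_eq_mul, mul_one]
  refine (measureReal_mono (inter_subset_left) (by simp)).trans ?_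
  simp [hh]

lemma eventually_eq_mul_stepFun {ι : Type*} [Fintype ι] {c : ℝ} (hc : c ∈ Icc a b) (β : ι → ℂ)
    (x : ι → ℝ) (hx : ∀ p, x p ∈ Icc a b) {t : ℝ} (ht : t ∈ Ico a b) :
    ∀ᶠ h in 𝓝[>] (0 : ℝ), ∑ p, β p * prim c (inclInf a b (cellInf a b t (t + h))) (x p) =
      h * stepFun c β x t := by
  filter_upwards [eventually_all.2 fun p => eventually_prim_inclInf_cellInf ht (hx p),
    eventually_prim_inclInf_cellInf ht hc] with h h1 h2
  rw [stepFun, Finset.mul_sum]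
  refine Finset.sum_congr rfl fun p _ => ?_
  have := prim_add_prim a c (inclInf a b (cellInf a b t (t + h))) (x p)
  rw [h1 p, h2] at this
  rw [eq_sub_of_add_eq' this]; ring

/-- The indicator of `(t, t+h]` has `L_1` norm at most `h`, and for small `h` the functional `l -
l'` maps it to exactly `h` times the difference of the step functions at `t`. Hence a bound at every
`t`, not merely almost everywhere, as one-sided limits require. -/
lemma norm_stepFun_sub_le {ι ι' : Type*} [Fintype ι] [Fintype ι'] {c : ℝ} (hc : c ∈ Icc a b)
    {β : ι → ℂ} {x : ι → ℝ} (hx : ∀ p, x p ∈ Icc a b) {β' : ι' → ℂ} {x' : ι' → ℝ}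
    (hx' : ∀ p, x' p ∈ Icc a b) {l l' : LOne a b →L[ℂ] ℂ}
    (hl : ∀ g, l g = ∑ p, β p * prim c g (x p)) (hl' : ∀ g, l' g = ∑ p, β' p * prim c g (x' p))
    {t : ℝ} (ht : t ∈ Ico a b) : ‖stepFun c β x t - stepFun c β' x' t‖ ≤ ‖l - l'‖ := by
  obtain ⟨h, h1, h2, h3⟩ := ((eventually_eq_mul_stepFun hc β x hx ht).and
    ((eventually_eq_mul_stepFun hc β' x' hx' ht).and
      (self_mem_nhdsWithin : Ioi (0 : ℝ) ∈ 𝓝[>] 0))).exists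
  have hh : 0 < h := h3
  have h4 := ((l - l').le_opNorm (inclInf a b (cellInf a b t (t + h)))).trans
    (mul_le_mul_of_nonneg_left (norm_inclInf_cellInf_le hh.le) (norm_nonneg _))
  rw [_root_.sub_apply, hl, hl', h1, h2, ← mul_sub, norm_mul, Complex.norm_real,
    Real.norm_of_nonneg hh.le, mul_comm] at h4
  exact le_of_mul_le_mul_right h4 hh

/-- The class of a step function in `L_∞`. -/
def stepInf {ι : Type*} [Fintype ι] (a b c : ℝ) (β : ι → ℂ) (x : ι → ℝ) : LInf a b :=
  ∑ p, β p • (cellInf a b a (x p) - cellInf a b a c)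

lemma stepInf_ae {ι : Type*} [Fintype ι] (c : ℝ) (β : ι → ℂ) (x : ι → ℝ) :
    stepInf a b c β x =ᵐ[volIcc a b] stepFun c β x := by
  have h0 : ∀ᵐ t ∂(volIcc a b), ∀ p, (β p • (cellInf a b a (x p) - cellInf a b a c) : LInf a b) t =
      β p * ((Iio (x p)).indicator (fun _ => (1 : ℂ)) t - (Iio c).indicator (fun _ => (1 : ℂ)) t) :=
    ae_all_iff.2 fun p => by
      filter_upwards [Lp.coeFn_smul (β p) (cellInf a b a (x p) - cellInf a b a c),
        Lp.coeFn_sub (cellInf a b a (x p)) (cellInf a b a c),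
        cellInf_ae_Iio (a := a) (b := b) (x p), cellInf_ae_Iio (a := a) (b := b) c] with t h1 h2 h3 h4
      rw [h1, Pi.smul_apply, h2, Pi.sub_apply, h3, h4, smul_eq_mul]
  filter_upwards [h0, Lp.coeFn_finsetSum Finset.univ fun p =>
    (β p • (cellInf a b a (x p) - cellInf a b a c) : LInf a b)] with t h1 h2
  rw [stepInf, h2, Finset.sum_apply, stepFun, Finset.sum_congr rfl fun p _ => h1 p]

lemma pairing_stepInf {ι : Type*} [Fintype ι] {c : ℝ} (hc : c ∈ Icc a b) (β : ι → ℂ) (x : ι → ℝ)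
    (hx : ∀ p, x p ∈ Icc a b) (g : LOne a b) :
    pairing a b (stepInf a b c β x) g = ∑ p, β p * prim c g (x p) := by
  rw [stepInf, map_sum, _root_.sum_apply]
  refine Finset.sum_congr rfl fun p _ => ?_
  rw [map_smul, map_sub, _root_.smul_apply, _root_.sub_apply, pairing_cellInf (hx p),
    pairing_cellInf hc, smul_eq_mul, ← prim_add_prim a c g (x p)]
  ring

/-- The step functions are uniformly Cauchy on `[a,b)`, so their pointwise limit `φ` has one-sided
limits. Their classes tend to that of `φ` in `L_∞`, and since the pairing determines its first
argument, `φ` represents `Φ`. -/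
lemma exists_isRegulatedOn_of_tendsto {Φ : LInf a b} {ι : ℕ → Type*}
    [∀ k, Fintype (ι k)] {c : ℝ} (hc : c ∈ Icc a b) {β : ∀ k, ι k → ℂ} {x : ∀ k, ι k → ℝ}
    (hx : ∀ k p, x k p ∈ Icc a b) {l : ℕ → LOne a b →L[ℂ] ℂ}
    (hl : ∀ k g, l k g = ∑ p, β k p * prim c g (x k p))
    (hlim : Tendsto l atTop (𝓝 (pairing a b Φ))) :
    ∃ φ : ℝ → ℂ, IsRegulatedOn a b φ ∧ Φ =ᵐ[volIcc a b] φ := by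
  set σ : ℕ → ℝ → ℂ := fun k => stepFun c (β k) (x k)
  have hσ : ∀ k j, ∀ t ∈ Ico a b, ‖σ k t - σ j t‖ ≤ ‖l k - l j‖ := fun k j t ht =>
    norm_stepFun_sub_le hc (hx k) (hx j) (hl k) (hl j) ht
  set ε : ℕ → ℝ := fun k => ‖l k - pairing a b Φ‖
  have hε : Tendsto ε atTop (𝓝 0) := tendsto_iff_norm_sub_tendsto_zero.1 hlim
  -- The limit gets the value 0 off `[a,b)`; the value at `b` affects neither the one-sided limits
  -- in question nor the class.
  have hconv : ∀ t : ℝ, ∃ z : ℂ, t ∈ Ico a b → Tendsto (fun k => σ k t) atTop (𝓝 z) := fun t => by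
    by_cases ht : t ∈ Ico a b
    · have hcau : CauchySeq fun k => σ k t := by
        refine Metric.cauchySeq_iff'.2 fun η hη => ?_
        obtain ⟨N, hN⟩ := Metric.cauchySeq_iff'.1 hlim.cauchySeq η hη
        refine ⟨N, fun n hn => ?_⟩
        have := hN n hn
        rw [dist_eq_norm] at this ⊢
        exact (hσ n N t ht).trans_lt this
      obtain ⟨z, hz⟩ := cauchySeq_tendsto_of_complete hcau
      exact ⟨z, fun _ => hz⟩
    · exact ⟨0, fun h => absurd h ht⟩
  choose φ hφ using hconv
  have hunif : ∀ k, ∀ t ∈ Ico a b, ‖σ k t - φ t‖ ≤ ε k := fun k t ht =>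
    le_of_tendsto_of_tendsto' ((tendsto_const_nhds.sub (hφ t ht)).norm)
      ((tendsto_const_nhds.sub hlim).norm) fun j => hσ k j t ht
  have hIco : ∀ᵐ t ∂(volIcc a b), t ∈ Ico a b := by
    have hne : ∀ᵐ t ∂(volIcc a b), t ≠ b := ae_restrict_of_ae (by simp [ae_iff])
    filter_upwards [hne, ae_restrict_mem measurableSet_Icc] with t h1 h2
    exact ⟨h2.1, lt_of_le_of_ne h2.2 h1⟩
  refine ⟨φ, ⟨fun t ht => ?_, fun t ht => ?_⟩, ?_⟩
  · exact exists_tendsto_of_uniform_approx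
      (mem_of_superset (Ioo_mem_nhdsGT ht.2) fun s hs =>
        (⟨ht.1.trans hs.1.le, hs.2⟩ : s ∈ Ico a b)) hε hunif
      fun k => exists_tendsto_stepFun _ _ _ fun x => (exists_tendsto_indicator_Iio x t).1
  · exact exists_tendsto_of_uniform_approx
      (mem_of_superset (Ioo_mem_nhdsLT ht.1) fun s hs =>
        (⟨hs.1.le, hs.2.trans_le ht.2⟩ : s ∈ Ico a b)) hε hunif
      fun k => exists_tendsto_stepFun _ _ _ fun x => (exists_tendsto_indicator_Iio x t).2
  · set S : ℕ → LInf a b := fun k => stepInf a b c (β k) (x k)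
    have hS : ∀ k, S k =ᵐ[volIcc a b] σ k := fun k => stepInf_ae c (β k) (x k)
    have hφm : AEStronglyMeasurable φ (volIcc a b) := by
      refine aestronglyMeasurable_of_tendsto_ae atTop (fun k => Lp.aestronglyMeasurable (S k)) ?_
      filter_upwards [ae_all_iff.2 hS, hIco] with t h1 h2
      simpa only [h1] using hφ t h2
    -- Boundedness of `φ` comes from its bounded distance to one step function.
    have hφ0 : MemLp (fun t => S 0 t - φ t) ⊤ (volIcc a b) := by
      refine memLp_top_of_bound ((Lp.aestronglyMeasurable (S 0)).sub hφm) (ε 0) ?_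
      filter_upwards [hS 0, hIco] with t h1 h2
      rw [h1]; exact hunif 0 t h2
    have hφL : MemLp φ ⊤ (volIcc a b) := by
      have := (Lp.memLp (S 0)).sub hφ0
      refine this.ae_eq (ae_of_all _ fun t => ?_)
      simp
    have hlimS : Tendsto S atTop (𝓝 hφL.toLp) := by
      refine tendsto_iff_norm_sub_tendsto_zero.2 (squeeze_zero (fun _ => norm_nonneg _)
        (fun k => ?_) hε)
      have h : ∀ᵐ t ∂(volIcc a b), ‖(S k - hφL.toLp : LInf a b) t‖ ≤ ε k := by
        filter_upwards [hS k, hIco, Lp.coeFn_sub (S k) hφL.toLp, hφL.coeFn_toLp] with t h1 h2 h3 h4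
        rw [h3, Pi.sub_apply, h1, h4]
        exact hunif k t h2
      have h2 := Lp.norm_le_of_ae_bound (norm_nonneg _) h
      simpa only [ENNReal.toReal_top, inv_zero, one_mul, Real.rpow_zero] using h2
    have hpair : ∀ k, pairing a b (S k) = l k := fun k => by
      ext g
      rw [pairing_stepInf hc _ _ (hx k), hl]
    have h3 := ((pairing a b).continuous.tendsto _).comp hlimS
    have h4 : pairing a b Φ = pairing a b hφL.toLp :=
      tendsto_nhds_unique hlim (h3.congr fun k => hpair k)
    rw [pairing_injective h4]
    exact hφL.coeFn_toLp

end Regulated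

/-! ### Fredholm alternative and operators into finite products. -/

section Functional

variable {E F : Type*} [NormedAddCommGroup E] [NormedSpace ℂ E] [NormedAddCommGroup F]
  [NormedSpace ℂ F]

/-- Riesz theory: `J + K = J (1 - C)` with `C = -J⁻¹K` compact, so 1 is an eigenvalue of `C` or lies
in its resolvent set. An eigenvector would lie in the kernel of `J + K`. -/
lemma exists_equiv_of_compact_perturbation [CompleteSpace E] (J : E ≃L[ℂ] F) {K : E →L[ℂ] F}
    (hK : IsCompactOperator K) (hinj : ∀ x, J x + K x = 0 → x = 0) :
    ∃ T : E ≃L[ℂ] F, (T : E →L[ℂ] F) = J + K := by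
  set C : E →L[ℂ] E := -((J.symm : F →L[ℂ] E) ∘L K)
  have hC : IsCompactOperator C := (hK.clm_comp (J.symm : F →L[ℂ] E)).neg
  have hJC : ∀ x, J (x - C x) = J x + K x := fun x => by simp [C]
  rcases hC.hasEigenvalue_or_mem_resolventSet (one_ne_zero (α := ℂ)) with h | h
  · obtain ⟨x, hx⟩ := h.exists_hasEigenvector
    have h1 : C x = x := by simpa using hx.apply_eq_smul
    exact absurd (hinj x (by rw [← hJC, h1]; simp)) hx.2
  · obtain ⟨u, hu⟩ := spectrum.mem_resolventSet_iff.1 h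
    refine ⟨(ContinuousLinearEquiv.ofUnit u).trans J, ?_⟩
    ext x
    have h1 : (u : E →L[ℂ] E) x = x - C x := by rw [hu]; simp
    change J ((u : E →L[ℂ] E) x) = J x + K x
    rw [h1, hJC]

lemma pi_eq_sum {ι : Type*} [Fintype ι] [DecidableEq ι] (f : ι → E →L[ℂ] F) :
    ContinuousLinearMap.pi f =
      ∑ i, ContinuousLinearMap.single ℂ (fun _ : ι => F) i ∘L f i := by
  ext x i
  simp [_root_.sum_apply, Finset.sum_apply, Pi.single_apply]

lemma tendsto_clm_pi {ι : Type*} [Fintype ι] {f : ℕ → ι → E →L[ℂ] F} {g : ι → E →L[ℂ] F}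
    (h : ∀ i, Tendsto (fun k => f k i) atTop (𝓝 (g i))) :
    Tendsto (fun k => ContinuousLinearMap.pi (f k)) atTop (𝓝 (ContinuousLinearMap.pi g)) := by
  classical
  simp only [pi_eq_sum]
  exact tendsto_finsetSum _ fun i _ =>
    ((ContinuousLinearMap.compL ℂ E F (ι → F)
      (ContinuousLinearMap.single ℂ (fun _ : ι => F) i)).continuous.tendsto _).comp (h i)

lemma isCompactOperator_clm_pi {ι : Type*} [Fintype ι] {f : ι → E →L[ℂ] F}
    (h : ∀ i, IsCompactOperator (f i)) : IsCompactOperator (ContinuousLinearMap.pi f) := by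
  classical
  rw [pi_eq_sum]
  exact isCompactOperator_finsetSum _ _ fun i _ => 
    (h i).clm_comp (ContinuousLinearMap.single ℂ (fun _ : ι => F) i)

lemma tendsto_clm_prod {G : Type*} [NormedAddCommGroup G] [NormedSpace ℂ G]
    {f : ℕ → E →L[ℂ] F} {f₀ : E →L[ℂ] F} {g : ℕ → E →L[ℂ] G} {g₀ : E →L[ℂ] G}
    (hf : Tendsto f atTop (𝓝 f₀)) (hg : Tendsto g atTop (𝓝 g₀)) :
    Tendsto (fun k => (f k).prod (g k)) atTop (𝓝 (f₀.prod g₀)) :=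
  ((ContinuousLinearMap.prodₗᵢ ℂ :
    ((E →L[ℂ] F) × (E →L[ℂ] G)) ≃ₗᵢ[ℂ] (E →L[ℂ] F × G)).continuous.tendsto (f₀, g₀)).comp
    (hf.prodMk_nhds hg)

lemma isCompactOperator_clm_prod {G : Type*} [NormedAddCommGroup G] [NormedSpace ℂ G]
    {f : E →L[ℂ] F} {g : E →L[ℂ] G} (hf : IsCompactOperator f) (hg : IsCompactOperator g) :
    IsCompactOperator (f.prod g) := by
  have := (hf.clm_comp (ContinuousLinearMap.inl ℂ F G)).add
    (hg.clm_comp (ContinuousLinearMap.inr ℂ F G))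
  refine (congrArg IsCompactOperator ?_).mp this
  ext x <;> simp

lemma tendsto_clm_comp {G : Type*} [NormedAddCommGroup G] [NormedSpace ℂ G]
    {f : ℕ → F →L[ℂ] G} {f₀ : F →L[ℂ] G} (hf : Tendsto f atTop (𝓝 f₀)) (g : E →L[ℂ] F) :
    Tendsto (fun k => f k ∘L g) atTop (𝓝 (f₀ ∘L g)) :=
  ((ContinuousLinearMap.precomp G g).continuous.tendsto f₀).comp hf

end Functional

/-- A shortcut to the normed group structure of `W_1^k`. -/
abbrev Sob.normedAddCommGroup' (a b : ℝ) (k : ℕ) : NormedAddCommGroup (Sob a b k) :=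
  Submodule.normedAddCommGroup _

attribute [local instance] Sob.normedAddCommGroup'

/-- A shortcut to the normed space structure of `W_1^k`. -/
abbrev Sob.normedSpace' (a b : ℝ) (k : ℕ) : NormedSpace ℂ (Sob a b k) :=
  Submodule.normedSpace _

attribute [local instance] Sob.normedSpace'

/-- A shortcut to the normed group structure of `(W_1^k)^m`. -/
abbrev SobVec.normedAddCommGroup' (a b : ℝ) (k m : ℕ) : NormedAddCommGroup (SobVec a b k m) :=
  PiLp.normedAddCommGroup 1 _

attribute [local instance] SobVec.normedAddCommGroup'

/-- A shortcut to the normed space structure of `(W_1^k)^m`. -/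
abbrev SobVec.normedSpace' (a b : ℝ) (k m : ℕ) : NormedSpace ℂ (SobVec a b k m) :=
  PiLp.normedSpace 1 ℂ _

attribute [local instance] SobVec.normedSpace'

/-! ### The boundary-value problem as a bounded operator, and its invertibility. -/

section Problem

variable {a b : ℝ} {n m r : ℕ}

/-- The multiplication `W_1^n × W_1^(n+1) → W_1^n`. -/
def Sob.mulL (hab : a < b) (n : ℕ) : Sob a b n →L[ℂ] Sob a b (n + 1) →L[ℂ] Sob a b n :=
  (Sob.exists_mul hab n).choose

lemma Sob.mulL_der (hab : a < b) (A : Sob a b n) (y : Sob a b (n + 1)) :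
    (Sob.mulL hab n A y).der 0 =ᵐ[volIcc a b] fun t => A.der 0 t * y.der 0 t :=
  (Sob.exists_mul hab n).choose_spec.1 A y

lemma Sob.isCompactOperator_mulL (hab : a < b) (A : Sob a b n) :
    IsCompactOperator (Sob.mulL hab n A) :=
  (Sob.exists_mul hab n).choose_spec.2 A

/-- The `i`-th component of an element of `(W_1^k)^m`. -/
def compL (a b : ℝ) (k m : ℕ) (i : Fin m) : SobVec a b k m →L[ℂ] Sob a b k :=
  PiLp.proj 1 (fun _ : Fin m => Sob a b k) i

/-- An operator into `(W_1^k)^m` from its components. -/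
def ofComponents {E : Type*} [NormedAddCommGroup E] [NormedSpace ℂ E] {k : ℕ}
    (f : Fin m → E →L[ℂ] Sob a b k) : E →L[ℂ] SobVec a b k m :=
  (PiLp.continuousLinearEquiv 1 ℂ (fun _ : Fin m => Sob a b k)).symm.toContinuousLinearMap ∘L
    ContinuousLinearMap.pi f

@[simp] lemma ofComponents_apply {E : Type*} [NormedAddCommGroup E] [NormedSpace ℂ E] {k : ℕ}
    (f : Fin m → E →L[ℂ] Sob a b k) (x : E) (i : Fin m) : ofComponents f x i = f i x := rfl

/-- The term `∑ A_j y^(j)` of lower order in the `i`-th equation of the system. -/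
def lowerRow (hab : a < b) (A : Coefficients a b n m r) (i : Fin m) :
    SolutionSpace a b n m r →L[ℂ] Sob a b n :=
  ∑ j : Fin r, ∑ l : Fin m, Sob.mulL hab n (A j i l) ∘L
    (Sob.shift a b (n + r) j (n + 1) (by omega) ∘L compL a b (n + r) m l)

/-- The operator `y ↦ y^(r)`. -/
def topDer (a b : ℝ) (n m r : ℕ) : SolutionSpace a b n m r →L[ℂ] SobVec a b n m :=
  ofComponents fun i => Sob.shift a b (n + r) r n (by omega) ∘L compL a b (n + r) m i

/-- The operator `L` of the system. -/
def diffOp (hab : a < b) (A : Coefficients a b n m r) :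
    SolutionSpace a b n m r →L[ℂ] SobVec a b n m :=
  topDer a b n m r + ofComponents (lowerRow hab A)

lemma Sob.ae_add_der_zero {k : ℕ} (y z : Sob a b k) :
    (y + z).der 0 =ᵐ[volIcc a b] fun t => y.der 0 t + z.der 0 t :=
  Lp.coeFn_add (y.der 0) (z.der 0)

lemma Sob.ae_sum_der_zero {k : ℕ} {ι : Type*} (s : Finset ι) (y : ι → Sob a b k)
    (f : ι → ℝ → ℂ) (h : ∀ i, (y i).der 0 =ᵐ[volIcc a b] f i) :
    (∑ i ∈ s, y i).der 0 =ᵐ[volIcc a b] fun t => ∑ i ∈ s, f i t := by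
  classical
  induction s using Finset.induction_on with
  | empty =>
    simp only [Finset.sum_empty]
    exact Lp.coeFn_zero ℂ 1 (volIcc a b)
  | insert i s hi ih =>
    simp only [Finset.sum_insert hi]
    exact (Sob.ae_add_der_zero _ _).trans ((h i).add ih)

lemma diffOp_der (hab : a < b) (A : Coefficients a b n m r) (y : SolutionSpace a b n m r)
    (i : Fin m) :
    (diffOp hab A y i).der 0 =ᵐ[volIcc a b] fun t => diffExpr A y t i := by
  refine (Sob.ae_add_der_zero (topDer a b n m r y i) (lowerRow hab A i y)).trans
    (EventuallyEq.add (EventuallyEq.refl _ _) ?_)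
  simp only [lowerRow, _root_.sum_apply]
  refine Sob.ae_sum_der_zero _ _ _ fun j => Sob.ae_sum_der_zero _ _ _ fun l => ?_
  exact Sob.mulL_der hab (A j i l) (Sob.shift a b (n + r) j (n + 1) (by omega) (y l))

/-- The rows of a boundary operator in canonical form. -/
def boundaryRow (t₀ : ℝ) (α : Fin (n + r) → Matrix (Fin (r * m)) (Fin m) ℂ)
    (Φ : Matrix (Fin (r * m)) (Fin m) (LInf a b)) (i : Fin (r * m)) :
    SolutionSpace a b n m r →L[ℂ] ℂ :=
  (∑ s, ∑ j, α s i j • (Sob.evL a b t₀ (n + r) s ∘L compL a b (n + r) m j)) +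
    ∑ j, pairing a b (Φ i j) ∘L (Sob.derL a b (n + r) (Fin.last (n + r)) ∘L compL a b (n + r) m j)

/-- The boundary operator in canonical form as a continuous operator. -/
def boundaryOp (t₀ : ℝ) (α : Fin (n + r) → Matrix (Fin (r * m)) (Fin m) ℂ)
    (Φ : Matrix (Fin (r * m)) (Fin m) (LInf a b)) :
    SolutionSpace a b n m r →L[ℂ] (Fin (r * m) → ℂ) :=
  ContinuousLinearMap.pi (boundaryRow t₀ α Φ)

lemma boundaryOp_apply (hab : a < b) {t₀ : ℝ} (ht₀ : t₀ ∈ Icc a b)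
    (α : Fin (n + r) → Matrix (Fin (r * m)) (Fin m) ℂ)
    (Φ : Matrix (Fin (r * m)) (Fin m) (LInf a b)) (y : SolutionSpace a b n m r) :
    boundaryOp t₀ α Φ y = canonicalBoundary t₀ α Φ y := by
  funext i
  rw [canonicalBoundary, Pi.add_apply, Finset.sum_apply,
    integral_finsetSum _ fun j _ => integrable_LInf_mul (Φ i j) ((y j).der (Fin.last (n + r)))]
  simp only [boundaryOp, boundaryRow, ContinuousLinearMap.coe_pi', _root_.add_apply,
    _root_.sum_apply, _root_.smul_apply, ContinuousLinearMap.comp_apply, pairing_apply]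
  congr 1
  refine Finset.sum_congr rfl fun s _ => Finset.sum_congr rfl fun j _ => ?_
  rw [pointDer, Sob.derAt_eq hab ht₀]
  rfl

/-- The operator `(L, B)` of a boundary-value problem. -/
def problemOp (hab : a < b) (t₀ : ℝ) (A : Coefficients a b n m r)
    (α : Fin (n + r) → Matrix (Fin (r * m)) (Fin m) ℂ)
    (Φ : Matrix (Fin (r * m)) (Fin m) (LInf a b)) :
    SolutionSpace a b n m r →L[ℂ] DataSpace a b n m r :=
  (diffOp hab A).prod (boundaryOp t₀ α Φ)

lemma isProblemOperator_problemOp (hab : a < b) {t₀ : ℝ} (ht₀ : t₀ ∈ Icc a b)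
    (A : Coefficients a b n m r) (α : Fin (n + r) → Matrix (Fin (r * m)) (Fin m) ℂ)
    (Φ : Matrix (Fin (r * m)) (Fin m) (LInf a b)) :
    IsProblemOperator A (canonicalBoundary t₀ α Φ) (problemOp hab t₀ A α Φ) := fun y =>
  ⟨diffOp_der hab A y, boundaryOp_apply hab ht₀ α Φ y⟩

/-- Multiplication and pairing are continuous in the coefficient in operator norm; this transfers
approximation of `A` in `W_1^n` and of `Φ` in `L_∞` to the problems. -/
lemma tendsto_problemOp (hab : a < b) (t₀ : ℝ) {A : ℕ → Coefficients a b n m r}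
    {A₀ : Coefficients a b n m r} (α : Fin (n + r) → Matrix (Fin (r * m)) (Fin m) ℂ)
    {Φ : ℕ → Matrix (Fin (r * m)) (Fin m) (LInf a b)}
    {Φ₀ : Matrix (Fin (r * m)) (Fin m) (LInf a b)}
    (hA : ∀ j i l, Tendsto (fun k => A k j i l) atTop (𝓝 (A₀ j i l)))
    (hΦ : ∀ i j, Tendsto (fun k => Φ k i j) atTop (𝓝 (Φ₀ i j))) :
    Tendsto (fun k => problemOp hab t₀ (A k) α (Φ k)) atTop (𝓝 (problemOp hab t₀ A₀ α Φ₀)) := by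
  refine tendsto_clm_prod (tendsto_const_nhds.add ?_) (tendsto_clm_pi fun i => ?_)
  · refine ((ContinuousLinearMap.compL ℂ _ _ _ (PiLp.continuousLinearEquiv 1 ℂ
      (fun _ : Fin m => Sob a b n)).symm.toContinuousLinearMap).continuous.tendsto _).comp
      (tendsto_clm_pi fun i => tendsto_finsetSum _ fun j _ => tendsto_finsetSum _ fun l _ => ?_)
    exact tendsto_clm_comp (((Sob.mulL hab n).continuous.tendsto _).comp (hA j i l)) _
  · refine tendsto_const_nhds.add (tendsto_finsetSum _ fun j _ => ?_)
    exact tendsto_clm_comp (((pairing a b).continuous.tendsto _).comp (hΦ i j)) _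

/-- The initial values `y^(s)(c)`, `s < r`, as an operator. -/
def initialOp (a b c : ℝ) (n m r : ℕ) : SolutionSpace a b n m r →L[ℂ] (Fin (r * m) → ℂ) :=
  ContinuousLinearMap.pi fun p => Sob.evL a b c (n + r) ⟨(finProdFinEquiv.symm p).1, by omega⟩ ∘L
    compL a b (n + r) m (finProdFinEquiv.symm p).2

lemma initialOp_apply (c : ℝ) (y : SolutionSpace a b n m r) (s : Fin r) (i : Fin m) :
    initialOp a b c n m r y (finProdFinEquiv (s, i)) =
      Sob.evL a b c (n + r) ⟨s, by omega⟩ (y i) := by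
  have h : ∀ (p : Fin r × Fin m) (q : Fin (r * m)), finProdFinEquiv.symm q = p →
      initialOp a b c n m r y q = Sob.evL a b c (n + r) ⟨p.1, by omega⟩ (y p.2) := by
    rintro _ q rfl
    rfl
  exact h (s, i) _ (finProdFinEquiv.symm_apply_apply (s, i))

lemma bijective_initial (hab : a < b) {c : ℝ} (hc : c ∈ Icc a b) (n m r : ℕ) :
    Function.Bijective ((topDer a b n m r).prod (initialOp a b c n m r)) := by
  have H := Sob.exists_unique_derivative_initial hab hc n r
  have hJ : ∀ (y : SolutionSpace a b n m r) (g : DataSpace a b n m r),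
      (topDer a b n m r).prod (initialOp a b c n m r) y = g ↔
      ∀ i : Fin m, Sob.shift a b (n + r) r n (by omega) (y i) = g.1 i ∧
        ∀ s : Fin r, Sob.evL a b c (n + r) ⟨s, by omega⟩ (y i) = g.2 (finProdFinEquiv (s, i)) := by
    intro y g
    constructor
    · rintro rfl i
      exact ⟨rfl, fun s => (initialOp_apply c y s i).symm⟩
    · intro h
      refine Prod.ext (PiLp.ext fun i => (h i).1) (funext fun p => ?_)
      obtain ⟨⟨s, i⟩, rfl⟩ := finProdFinEquiv.surjective p
      exact (initialOp_apply c y s i).trans ((h i).2 s)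
  constructor
  · intro y z hyz
    have h1 := (hJ y _).1 hyz
    have h2 := (hJ z _).1 rfl
    exact PiLp.ext fun i => (H _ _).unique (h1 i) (h2 i)
  · intro g
    refine ⟨WithLp.toLp 1 fun i => (H (g.1 i) fun s => g.2 (finProdFinEquiv (s, i))).choose,
      (hJ _ g).2 fun i => ?_⟩
    exact (H (g.1 i) fun s => g.2 (finProdFinEquiv (s, i))).choose_spec.1

/-- The problem is the model problem `J` plus `K`. The lower-order part of `K` is compact since
`y^(j)` with `j < r` lies in `W_1^(n+1)`; its boundary part has values in a finite-dimensional
space. -/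
lemma exists_equiv_problemOp (hab : a < b) {t₀ : ℝ} (ht₀ : t₀ ∈ Icc a b)
    (A : Coefficients a b n m r) (α : Fin (n + r) → Matrix (Fin (r * m)) (Fin m) ℂ)
    (Φ : Matrix (Fin (r * m)) (Fin m) (LInf a b))
    (hinj : ∀ y, problemOp hab t₀ A α Φ y = 0 → y = 0) :
    ∃ T : SolutionSpace a b n m r ≃L[ℂ] DataSpace a b n m r,
      (T : SolutionSpace a b n m r →L[ℂ] DataSpace a b n m r) = problemOp hab t₀ A α Φ := by
  have := Sob.completeSpace hab (n + r)
  have := Sob.completeSpace hab n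
  -- The open mapping theorem makes the inverse continuous; this is where completeness of both
  -- Sobolev spaces enters.
  let J := ContinuousLinearEquiv.ofBijective _
    (LinearMap.ker_eq_bot.2 (bijective_initial hab ht₀ n m r).1)
    (LinearMap.range_eq_top.2 (bijective_initial hab ht₀ n m r).2)
  let K : SolutionSpace a b n m r →L[ℂ] DataSpace a b n m r :=
    (ofComponents (lowerRow hab A)).prod (boundaryOp t₀ α Φ - initialOp a b t₀ n m r)
  have hJK : problemOp hab t₀ A α Φ = J + K := by
    refine ContinuousLinearMap.ext fun y => Prod.ext rfl ?_
    change boundaryOp t₀ α Φ y =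
      initialOp a b t₀ n m r y + (boundaryOp t₀ α Φ y - initialOp a b t₀ n m r y)
    abel
  have hK : IsCompactOperator K := by
    refine isCompactOperator_clm_prod ?_ (isCompactOperator_of_locallyCompactSpace_dom _)
    refine (isCompactOperator_clm_pi fun i => isCompactOperator_finsetSum _ _ fun j _ =>
      isCompactOperator_finsetSum _ _ fun l _ => ?_).clm_comp (PiLp.continuousLinearEquiv 1 ℂ
        (fun _ : Fin m => Sob a b n)).symm.toContinuousLinearMap
    exact (Sob.isCompactOperator_mulL hab (A j i l)).comp_clm _
  rw [hJK] at hinj ⊢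
  exact exists_equiv_of_compact_perturbation J hK hinj

end Problem
end

noncomputable section

attribute [local instance] Sob.normedAddCommGroup'
attribute [local instance] Sob.normedSpace'
attribute [local instance] SobVec.normedAddCommGroup'
attribute [local instance] SobVec.normedSpace'

/-! ### Multipoint problems: construction from step functions and passage to the limit. -/

section Multipoint

variable {a b : ℝ} {n m r : ℕ}

lemma exists_nodes_of_mem_stepSpan (hab : a < b) {k : ℕ} (s : Fin k) (hs : s.succ = Fin.last k)
    {S : LInf a b} (hS : S ∈ stepSpan a b) :
    ∃ (ι : Type) (_ : Fintype ι) (β : ι → ℂ) (x : ι → ℝ), (∀ p, x p ∈ Icc a b) ∧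
      ∀ y : Sob a b k, pairing a b S (y.der (Fin.last k)) = ∑ p, β p * y.derAt s (x p) := by
  have ha : a ∈ Icc a b := left_mem_Icc.2 hab.le
  induction hS using Submodule.span_induction with
  | mem S hS =>
    obtain ⟨x, hx, rfl⟩ := hS
    -- Two nodes, `x` with weight 1 and `a` with weight -1, because the pairing with the indicator
    -- is a difference of two values.
    refine ⟨Bool, inferInstance, fun c => bif c then 1 else -1, fun c => bif c then x else a,
      fun c => by cases c; exacts [ha, hx], fun y => ?_⟩
    change pairing a b (cellInf a b a x) _ = _
    rw [pairing_cellInf hx, ← hs, Fintype.sum_bool]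
    simp only [cond_true, cond_false, Sob.derAt_eq hab hx, Sob.derAt_eq hab ha]
    rw [Sob.evL_eq_add_prim hab ha hx]; ring
  | zero => exact ⟨Empty, inferInstance, fun _ => 0, fun _ => a, fun _ => ha, fun y => by simp⟩
  | add S S' _ _ h h' =>
    obtain ⟨ι, _, β, x, hx, h⟩ := h
    obtain ⟨ι', _, β', x', hx', h'⟩ := h'
    refine ⟨ι ⊕ ι', inferInstance, Sum.elim β β', Sum.elim x x',
      fun p => by cases p; exacts [hx _, hx' _], fun y => ?_⟩
    rw [map_add, _root_.add_apply, h, h', Fintype.sum_sum_type]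
    rfl
  | smul c S _ h =>
    obtain ⟨ι, _, β, x, hx, h⟩ := h
    refine ⟨ι, inferInstance, fun p => c * β p, x, hx, fun y => ?_⟩
    rw [map_smul, _root_.smul_apply, h, smul_eq_mul, Finset.mul_sum]
    exact Finset.sum_congr rfl fun p _ => (mul_assoc _ _ _).symm

lemma exists_multipointBoundary_eq (hab : a < b) (hr : 1 ≤ r) (t₀ : ℝ)
    (α : Fin (n + r) → Matrix (Fin (r * m)) (Fin m) ℂ)
    {Φ : Matrix (Fin (r * m)) (Fin m) (LInf a b)} (hΦ : ∀ i j, Φ i j ∈ stepSpan a b) :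
    ∃ (N : ℕ) (β : Fin (N + 1) → Matrix (Fin (r * m)) (Fin m) ℂ) (node : Fin (N + 1) → ℝ),
      (∀ q, node q ∈ Icc a b) ∧ ∀ y : SolutionSpace a b n m r,
        multipointBoundary hr t₀ α β node y = canonicalBoundary t₀ α Φ y := by
  classical
  set s : Fin (n + r) := ⟨n + r - 1, by omega⟩
  have hs : s.succ = Fin.last (n + r) := Fin.ext (by simp [s]; omega)
  have H := fun i j => exists_nodes_of_mem_stepSpan hab s hs (hΦ i j)
  choose ι hι β x hx H using H
  -- Each node of each entry of `Φ` carries a matrix with a single possibly nonzero entry. The extra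
  -- element `none` is a node at `a` with zero matrix, which brings the number of nodes to the form
  -- `N + 1`.
  let κ := Option ((i : Fin (r * m)) × (j : Fin m) × ι i j)
  let e : Fin (Fintype.card ((i : Fin (r * m)) × (j : Fin m) × ι i j) + 1) ≃ κ :=
    (Fintype.equivFinOfCardEq (Fintype.card_option)).symm
  let β' : κ → Matrix (Fin (r * m)) (Fin m) ℂ := fun q =>
    q.elim 0 fun p => Matrix.single p.1 p.2.1 (β p.1 p.2.1 p.2.2)
  let x' : κ → ℝ := fun q => q.elim a fun p => x p.1 p.2.1 p.2.2
  refine ⟨_, fun q => β' (e q), fun q => x' (e q), fun q => ?_, fun y => ?_⟩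
  · change x' (e q) ∈ Icc a b
    cases e q with
    | none => exact left_mem_Icc.2 hab.le
    | some p => exact hx _ _ _
  · rw [multipointBoundary, canonicalBoundary]
    congr 1
    rw [e.sum_comp fun q => (β' q).mulVec (pointDer y s (x' q)), Fintype.sum_option]
    funext i
    rw [integral_finsetSum _ fun j _ => integrable_LInf_mul (Φ i j) ((y j).der (Fin.last (n + r)))]
    simp only [← pairing_apply, H]
    simp only [β', x', Option.elim, Matrix.zero_mulVec, zero_add, Finset.sum_apply,
      Fintype.sum_sigma, Matrix.single_mulVec]
    rw [Finset.sum_eq_single i]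
    · simp [pointDer]
    · intro i' _ hi'
      simp [hi'.symm]
    · simp

/-- The multipoint problem with polynomial coefficients attached to step functions. -/
lemma exists_multipointProblem (hab : a < b) (hr : 1 ≤ r) {t₀ : ℝ} (ht₀ : t₀ ∈ Icc a b)
    {A : Coefficients a b n m r} (hA : ∀ j i l, (A j i l).IsPolynomial)
    (α : Fin (n + r) → Matrix (Fin (r * m)) (Fin m) ℂ)
    {Φ : Matrix (Fin (r * m)) (Fin m) (LInf a b)} (hΦ : ∀ i j, Φ i j ∈ stepSpan a b) :
    ∃ Q : MultipointProblem a b n m r,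
      IsProblemOperator Q.A (multipointBoundary hr t₀ Q.α Q.β Q.node)
        (problemOp hab t₀ A α Φ) := by
  obtain ⟨N, β, x, hx, h⟩ := exists_multipointBoundary_eq hab hr t₀ α hΦ
  refine ⟨⟨A, hA, α, N, β, x, hx⟩, ?_⟩
  rw [show multipointBoundary hr t₀ α β x = canonicalBoundary t₀ α Φ from funext h]
  exact isProblemOperator_problemOp hab ht₀ A α Φ

lemma exists_polynomial_tendsto (hab : a < b) (f₀ : SobVec a b n m) :
    ∃ f : ℕ → SobVec a b n m, (∀ k i, (f k i).IsPolynomial) ∧ Tendsto f atTop (𝓝 f₀) := by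
  have H := fun i => mem_closure_iff_seq_limit.1 (Sob.dense_isPolynomial hab n (f₀ i))
  choose f hf hlim using H
  exact ⟨fun k => WithLp.toLp 1 fun i => f i k, fun k i => hf i k,
    ((PiLp.continuous_toLp 1 fun _ : Fin m => Sob a b n).tendsto _).comp (tendsto_pi_nhds.2 hlim)⟩

/-- Inversion is continuous at an invertible operator on a complete space. It is applied to the
problems and, in the converse direction, to their inverses. -/
lemma tendsto_symm_of_tendsto {E F : Type*} [NormedAddCommGroup E] [NormedSpace ℂ E]
    [NormedAddCommGroup F] [NormedSpace ℂ F] [CompleteSpace E] {T : ℕ → E ≃L[ℂ] F} {T₀ : E ≃L[ℂ] F}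
    (h : Tendsto (fun k => (T k : E →L[ℂ] F)) atTop (𝓝 (T₀ : E →L[ℂ] F))) :
    Tendsto (fun k => ((T k).symm : F →L[ℂ] E)) atTop (𝓝 (T₀.symm : F →L[ℂ] E)) := by
  have h1 := (contDiffAt_map_inverse (𝕜 := ℂ) (n := 0) T₀).continuousAt.tendsto.comp h
  simpa only [Function.comp_def, ContinuousLinearMap.inverse_equiv] using h1

lemma exists_approximation (hab : a < b) (hr : 1 ≤ r) {t₀ : ℝ} (ht₀ : t₀ ∈ Icc a b)
    (A₀ : Coefficients a b n m r) (α₀ : Fin (n + r) → Matrix (Fin (r * m)) (Fin m) ℂ)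
    (Φ₀ : Matrix (Fin (r * m)) (Fin m) (LInf a b))
    (T₀ : SolutionSpace a b n m r ≃L[ℂ] DataSpace a b n m r)
    (hT₀ : (T₀ : SolutionSpace a b n m r →L[ℂ] DataSpace a b n m r) = problemOp hab t₀ A₀ α₀ Φ₀)
    (hΦ : ∀ i j, Φ₀ i j ∈ closure (stepSpan a b : Set (LInf a b))) :
    ∃ (Q : ℕ → MultipointProblem a b n m r)
      (T : ℕ → (SolutionSpace a b n m r ≃L[ℂ] DataSpace a b n m r)),
      (∀ k, IsProblemOperator (Q k).A
        (multipointBoundary hr t₀ (Q k).α (Q k).β (Q k).node) (T k)) ∧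
      Tendsto (fun k => ((T k).symm : DataSpace a b n m r →L[ℂ] SolutionSpace a b n m r)) atTop
        (𝓝 (T₀.symm : DataSpace a b n m r →L[ℂ] SolutionSpace a b n m r)) := by
  have := Sob.completeSpace hab (n + r)
  have HΦ := fun i j => mem_closure_iff_seq_limit.1 (hΦ i j)
  choose Φ hΦm hΦl using HΦ
  have HA := fun j i l => mem_closure_iff_seq_limit.1 (Sob.dense_isPolynomial hab n (A₀ j i l))
  choose A hAm hAl using HA
  have hlim := tendsto_problemOp hab t₀ (A := fun k j i l => A j i l k) α₀
    (Φ := fun k i j => Φ i j k) hAl hΦl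
  rw [← hT₀] at hlim
  -- Invertible operators form an open set, so the approximating problems are well posed from index
  -- `K` on; the sequence is shifted by `K`.
  obtain ⟨K, hK⟩ := eventually_atTop.1 (hlim.eventually (ContinuousLinearEquiv.nhds T₀))
  have HT := fun k => hK (k + K) (Nat.le_add_left K k)
  choose T hT using HT
  have HQ := fun k => exists_multipointProblem hab hr ht₀ (A := fun j i l => A j i l (k + K))
    (fun j i l => hAm j i l (k + K)) α₀ (Φ := fun i j => Φ i j (k + K)) fun i j => hΦm i j (k + K)
  choose Q hQ using HQ
  refine ⟨Q, T, fun k => ?_, tendsto_symm_of_tendsto ?_⟩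
  · have h1 := hQ k
    rw [← hT k] at h1
    exact h1
  · simp only [hT]
    exact hlim.comp (tendsto_add_atTop_nat K)

/-- The element of `(W_1^k)^m` whose only nonzero component is the `j`-th one. -/
lemma exists_test_functions (hab : a < b) {c : ℝ} (hc : c ∈ Icc a b) (j : Fin m) :
    ∃ R : LOne a b →L[ℂ] SolutionSpace a b n m r, ∀ g,
      (∀ l, (R g l).der (Fin.last (n + r)) = if l = j then g else 0) ∧
      (∀ s, pointDer (R g) s c = 0) ∧
      ∀ s : Fin (n + r), s.succ = Fin.last (n + r) → ∀ x ∈ Icc a b,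
        pointDer (R g) s x = Pi.single j (prim c g x) := by
  obtain ⟨R, hR⟩ := Sob.exists_primitive hab (c := c) (n + r)
  let R' : LOne a b →L[ℂ] SolutionSpace a b n m r :=
    ofComponents fun l => if l = j then R else 0
  have h1 : ∀ g, R' g j = R g := fun g => by simp [R']
  have h2 : ∀ g l, l ≠ j → R' g l = 0 := fun g l hl => by simp [R', hl]
  refine ⟨R', fun g => ⟨fun l => ?_, fun s => ?_, fun s hs x hx => ?_⟩⟩
  · by_cases hl : l = j
    · subst hl
      rw [h1, if_pos rfl, (hR g).1]
    · rw [h2 g l hl, if_neg hl]; rfl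
  · funext l
    rw [pointDer, Sob.derAt_eq hab hc]
    by_cases hl : l = j
    · subst hl
      rw [h1, (hR g).2]; rfl
    · rw [h2 g l hl, map_zero]; rfl
  · funext l
    rw [pointDer, Sob.derAt_eq hab hx]
    by_cases hl : l = j
    · subst hl
      rw [h1, Sob.evL_eq_add_prim hab hc hx, (hR g).2, zero_add, hs, (hR g).1, Pi.single_eq_same]
    · rw [h2 g l hl, map_zero, Pi.single_eq_of_ne hl]

/-- The test functions have vanishing derivatives at `t₀` up to order `n + r - 1`, which removes all
the terms with `α`, and only the `j`-th component is nonzero. The `i`-th boundary value is then the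
pairing with `Φ₀ i j` in the limit problem and a combination of `∫_{t₀}^x g` over the nodes `x` in
the multipoint ones. -/
lemma exists_isRegulatedOn_of_approximation (hab : a < b) (hr : 1 ≤ r) {t₀ : ℝ} (ht₀ : t₀ ∈ Icc a b)
    {A₀ : Coefficients a b n m r} {α₀ : Fin (n + r) → Matrix (Fin (r * m)) (Fin m) ℂ}
    {Φ₀ : Matrix (Fin (r * m)) (Fin m) (LInf a b)}
    {T₀ : SolutionSpace a b n m r ≃L[ℂ] DataSpace a b n m r}
    (hT₀ : IsProblemOperator A₀ (canonicalBoundary t₀ α₀ Φ₀) T₀)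
    {Q : ℕ → MultipointProblem a b n m r}
    {T : ℕ → (SolutionSpace a b n m r ≃L[ℂ] DataSpace a b n m r)}
    (hT : ∀ k, IsProblemOperator (Q k).A
        (multipointBoundary hr t₀ (Q k).α (Q k).β (Q k).node) (T k))
    (hlim : Tendsto (fun k => ((T k).symm : DataSpace a b n m r →L[ℂ] SolutionSpace a b n m r))
      atTop (𝓝 (T₀.symm : DataSpace a b n m r →L[ℂ] SolutionSpace a b n m r)))
    (i : Fin (r * m)) (j : Fin m) :
    ∃ φ : ℝ → ℂ, IsRegulatedOn a b φ ∧ Φ₀ i j =ᵐ[volIcc a b] φ := by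
  have := Sob.completeSpace hab n
  have h1 := tendsto_symm_of_tendsto hlim
  simp only [ContinuousLinearEquiv.symm_symm] at h1
  obtain ⟨R, hR⟩ := exists_test_functions (n := n) (r := r) hab ht₀ j
  set s : Fin (n + r) := ⟨n + r - 1, by omega⟩
  have hs : s.succ = Fin.last (n + r) := Fin.ext (by simp [s]; omega)
  let P : DataSpace a b n m r →L[ℂ] ℂ :=
    ContinuousLinearMap.proj (φ := fun _ : Fin (r * m) => ℂ) i ∘L
      ContinuousLinearMap.snd ℂ (SobVec a b n m) (Fin (r * m) → ℂ)
  have h2 : Tendsto (fun k => P ∘L ((T k : SolutionSpace a b n m r →L[ℂ] DataSpace a b n m r) ∘L R))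
      atTop (𝓝 (P ∘L ((T₀ : SolutionSpace a b n m r →L[ℂ] DataSpace a b n m r) ∘L R))) :=
    ((ContinuousLinearMap.postcomp (LOne a b) P).continuous.tendsto _).comp (tendsto_clm_comp h1 R)
  have h3 : P ∘L ((T₀ : SolutionSpace a b n m r →L[ℂ] DataSpace a b n m r) ∘L R) =
      pairing a b (Φ₀ i j) := by
    ext g
    change (T₀ (R g)).2 i = _
    rw [(hT₀ (R g)).2, canonicalBoundary]
    simp only [(hR g).2.1, Matrix.mulVec_zero, Finset.sum_const_zero, zero_add]
    rw [integral_finsetSum _ fun l _ => integrable_LInf_mul (Φ₀ i l) ((R g l).der (Fin.last (n + r)))]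
    simp only [← pairing_apply, (hR g).1]
    rw [Finset.sum_eq_single j (fun l _ hl => by rw [if_neg hl, map_zero]) (by simp), if_pos rfl]
  rw [h3] at h2
  refine exists_isRegulatedOn_of_tendsto ht₀ (ι := fun k => Fin ((Q k).N + 1))
    (β := fun k q => (Q k).β q i j) (x := fun k => (Q k).node) (fun k => (Q k).node_mem)
    (fun k g => ?_) h2
  change (T k (R g)).2 i = _
  rw [(hT k (R g)).2, multipointBoundary]
  simp only [(hR g).2.1, Matrix.mulVec_zero, Finset.sum_const_zero, zero_add, Finset.sum_apply]
  refine Finset.sum_congr rfl fun q _ => ?_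
  rw [(hR g).2.2 s hs _ ((Q k).node_mem q), Matrix.mulVec_single]
  simp

end Multipoint
end

noncomputable section
-- Convergence of solutions and the main theorem.
section Convergence

variable {E F : Type*} [SeminormedAddCommGroup E] [NormedSpace ℂ E] [SeminormedAddCommGroup F]
  [NormedSpace ℂ F]

lemma tendsto_clm_iff_norm (S : ℕ → E →L[ℂ] F) (S₀ : E →L[ℂ] F) :
    Tendsto S atTop (𝓝 S₀) ↔ Tendsto (fun k => ‖S k - S₀‖) atTop (𝓝 0) :=
  tendsto_iff_norm_sub_tendsto_zero

lemma tendsto_symm_apply {T : ℕ → E ≃L[ℂ] F} {T₀ : E ≃L[ℂ] F}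
    (h : Tendsto (fun k => ((T k).symm : F →L[ℂ] E)) atTop (𝓝 (T₀.symm : F →L[ℂ] E))) {x : ℕ → F}
    {x₀ : F} (hx : Tendsto x atTop (𝓝 x₀)) :
    Tendsto (fun k => (T k).symm (x k)) atTop (𝓝 (T₀.symm x₀)) :=
  (isBoundedBilinearMap_apply.continuous.tendsto ((T₀.symm : F →L[ℂ] E), x₀)).comp
    (h.prodMk_nhds hx)

end Convergence

/-- Evaluation of an operator at a vector is jointly continuous, so norm convergence of the inverses
handles varying right-hand sides as well. -/
lemma isApproximation_of_tendsto {a b : ℝ} {n m r : ℕ} (hab : a < b) (hr : 1 ≤ r) {t₀ : ℝ}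
    {T₀ : SolutionSpace a b n m r ≃L[ℂ] DataSpace a b n m r}
    {Q : ℕ → MultipointProblem a b n m r}
    {T : ℕ → (SolutionSpace a b n m r ≃L[ℂ] DataSpace a b n m r)}
    (hT : ∀ k, IsProblemOperator (Q k).A
        (multipointBoundary hr t₀ (Q k).α (Q k).β (Q k).node) (T k))
    (hlim : Tendsto (fun k => ((T k).symm : DataSpace a b n m r →L[ℂ] SolutionSpace a b n m r))
      atTop (𝓝 (T₀.symm : DataSpace a b n m r →L[ℂ] SolutionSpace a b n m r))) :
    IsApproximation hr t₀ T₀ Q T where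
  isOperator := hT
  strong _ := tendsto_symm_apply (E := SolutionSpace a b n m r) (F := DataSpace a b n m r) hlim
    tendsto_const_nhds
  exists_polynomial := exists_polynomial_tendsto hab
  solutions _ _ _ _ _ hf hc := tendsto_symm_apply (E := SolutionSpace a b n m r)
    (F := DataSpace a b n m r) hlim (hf.prodMk_nhds hc)

theorem mainTheorem7 (a b : ℝ) (hab : a < b) (n m r : ℕ) (hm : 1 ≤ m) (hr : 1 ≤ r)
    (t₀ : ℝ) (ht₀ : t₀ ∈ Set.Icc a b)
    (A₀ : Coefficients a b n m r)
    (α₀ : Fin (n + r) → Matrix (Fin (r * m)) (Fin m) ℂ)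
    (Φ₀ : Matrix (Fin (r * m)) (Fin m) (LInf a b))
    (h₀ : ∀ y : SolutionSpace a b n m r,
      (∀ i, ∀ᵐ t ∂(MeasureTheory.volume.restrict (Set.Icc a b)), diffExpr A₀ y t i = 0) →
      canonicalBoundary t₀ α₀ Φ₀ y = 0 → y = 0) :
    ∃ T₀ : SolutionSpace a b n m r ≃L[ℂ] DataSpace a b n m r,
      IsProblemOperator A₀ (canonicalBoundary t₀ α₀ Φ₀) T₀ ∧
      ((∃ (Q : ℕ → MultipointProblem a b n m r)
          (T : ℕ → (SolutionSpace a b n m r ≃L[ℂ] DataSpace a b n m r)),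
          IsApproximation hr t₀ T₀ Q T ∧
          Filter.Tendsto
            (fun k => ‖((T k).symm : DataSpace a b n m r →L[ℂ] SolutionSpace a b n m r) -
              (T₀.symm : DataSpace a b n m r →L[ℂ] SolutionSpace a b n m r)‖)
            Filter.atTop (nhds 0)) ↔
        ∀ i j, ∃ φ : ℝ → ℂ, IsRegulatedOn a b φ ∧
          Φ₀ i j =ᵐ[MeasureTheory.volume.restrict (Set.Icc a b)] φ) := by
  obtain ⟨T₀, hT₀⟩ := exists_equiv_problemOp hab ht₀ A₀ α₀ Φ₀ fun y hy => by
    refine h₀ y (fun i => ?_) ?_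
    · filter_upwards [diffOp_der hab A₀ y i, Lp.coeFn_zero ℂ 1 (volIcc a b)] with t h1 h2
      have h3 : diffOp hab A₀ y = 0 := congrArg Prod.fst hy
      rw [← h1, h3]
      exact h2
    · rw [← boundaryOp_apply hab ht₀]
      exact congrArg Prod.snd hy
  have hop : IsProblemOperator A₀ (canonicalBoundary t₀ α₀ Φ₀) T₀ := by
    have h1 := isProblemOperator_problemOp hab ht₀ A₀ α₀ Φ₀
    rw [← hT₀] at h1
    exact h1
  refine ⟨T₀, hop, ?_, fun hΦ => ?_⟩
  · rintro ⟨Q, T, hQT, hlim⟩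
    have hlim' := (tendsto_clm_iff_norm (E := DataSpace a b n m r)
      (F := SolutionSpace a b n m r) _ _).2 hlim
    exact exists_isRegulatedOn_of_approximation hab hr ht₀ hop hQT.isOperator hlim'
  · obtain ⟨Q, T, hop', hlim⟩ := exists_approximation hab hr ht₀ A₀ α₀ Φ₀ T₀ hT₀ fun i j => by
      obtain ⟨φ, hφ, hφΦ⟩ := hΦ i j
      exact mem_closure_stepSpan hab hφ hφΦ
    exact ⟨Q, T, isApproximation_of_tendsto hab hr hop' hlim,
      (tendsto_clm_iff_norm (E := DataSpace a b n m r) (F := SolutionSpace a b n m r) _ _).1 hlim⟩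
end
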